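/- Let $\langle f,g\rangle=\int_{\mathbb R} f(x)\overline{g(x)}\,dx$, let $\theta$ be the Heaviside function, and for nonreal $z$ put $$g_z(x)=i\,\mathrm{sign}(\mathrm{Im}\,z)\,\theta(-x\,\mathrm{Im}\,z)\,e^{-izx},$$ $$\beta(z,\alpha)=i(1-e^{-i\alpha})\theta(\mathrm{Im}\,z)+i(e^{i\alpha}-1)\theta(-\mathrm{Im}\,z),\qquad \mathcal G_z(x,y;\alpha)=g_z(x-y)+g_z(x)\,\beta(z,\alpha)\,\overline{g_{\bar z}(y)} .$$ Let $v\in L_2(\mathbb R)$ (complex-valued) and $\alpha\in\mathbb R$. Let $A(v,\alpha)$ be the operator in $L_2(\mathbb R)$ acting as $$A(v,\alpha)\psi=i\psi'+v\,\tfrac12\bigl[\psi(-0)+e^{-i\alpha}\psi(+0)\bigr]$$ (with $\psi'$ the weak derivative on $\mathbb R\setminus\{0\}$) on the domain of all $\psi\in W_2^1(\mathbb R\setminus\{0\})$ (that is, $\psi,\psi'\in L_2$) which satisfy $$i\psi(-0)-ie^{-i\alpha}\psi(+0)=\langle\psi,v\rangle .$$ (I) $A(v,\alpha)$ is densely defined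 and self-adjoint in $L_2(\mathbb R)$. (II) Let $z\in\mathbb C\setminus\mathbb R$, and put $$E_1(x,z)=\mathcal G_z(x,-0;\alpha),\qquad E_2(x,z)=\int\mathcal G_z(x,y;\alpha)v(y)\,dy .$$ These functions of $x$ belong to $L_2$. Let $\Gamma(z)=(\gamma_{jk}(z))_{j,k=1,2}$ with $$\gamma_{11}(z)=-\langle E_2(\cdot,z),v\rangle,\quad \gamma_{12}(z)=1+\langle v,E_1(\cdot,\bar z)\rangle,\quad \gamma_{21}(z)=1+\langle E_1(\cdot,z),v\rangle,\quad \gamma_{22}(z)=-\tfrac i2\,\mathrm{sign}(\mathrm{Im}\,z),$$ and $\gamma(z)=\det\Gamma(z)$. Then $\Gamma(\bar z)^*=\Gamma(z)$, $\overline{\gamma(\bar z)}=\gamma(z)\ne0$, and the resolvent $(A(v,\alpha)-zI)^{-1}$ exists as a bounded operator on $L_2(\mathbb R)$ and is the integral operator with kernel $$\mathcal G_z(x,y;v,\alpha)=\mathcal G_z(x,y;\alpha)+\frac1{\gamma(z)}\sum_{j,k=1}^2E_j(x,z)\,\gamma_{jk}(z)\,\overline{E_k(y,\bar z)} ,$$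 a perturbation of $\mathcal G_z(x,y;\alpha)$ of rank at most $2$. (III) Let $z\in\mathbb C\setminus\mathbb R$, and put $$e_1(x,z)=g_z(x),\qquad e_2(x,z)=\int g_z(x-y)v(y)\,dy .$$ These functions of $x$ belong to $L_2$. There are complex numbers $c_{jk}$ (depending on $z,v,\alpha$) such that for all $x\ne0$, $y\ne0$ $$\mathcal G_z(x,y;v,\alpha)=g_z(x-y)-\sum_{j,k=1}^2e_j(x,z)\,c_{jk}\,\overline{e_k(y,\bar z)} ,$$ and the resolvent $(A(v,\alpha)-zI)^{-1}$ is the integral operator with the kernel on the right-hand side, a perturbation of the free kernel $g_z(x-y)$ of rank at most $2$. If $e^{i\alpha}\ne-1$, one may take $c_{jk}=\widetilde\gamma_{jk}(z)/\widetilde\gamma(z)$, where $$\widetilde\gamma_{11}(z)=\langle e_2(\cdot,z),v\rangle-\frac{2i(1-e^{i\alpha})}{1+e^{i\alpha}},\qquad \widetilde\gamma_{12}(z)=-\frac2{1+e^{-i\alpha}}-\langle v,g_{\bar z}\rangle,$$ $$\widetilde\gamma_{21}(z)=-\frac2{1+e^{i\alpha}}-\langle g_z,v\rangle,\qquad \widetilde\gamma_{22}(z)=\frac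 i{1+e^{-i\alpha}}\bigl[\theta(\mathrm{Im}\,z)-e^{-i\alpha}\theta(-\mathrm{Im}\,z)\bigr],$$ and $\widetilde\gamma(z)=\det\widetilde\Gamma(z)$ with $\widetilde\Gamma(z)=(\widetilde\gamma_{jk}(z))$; moreover $\widetilde\Gamma(\bar z)^*=\widetilde\Gamma(z)$ and $\overline{\widetilde\gamma(\bar z)}=\widetilde\gamma(z)\ne0$. -/

import Mathlib

open MeasureTheory Filter Topology Complex
open scoped ComplexConjugate ContDiff Matrix

noncomputable section

/-- The Hilbert space of square-integrable complex functions on the real line. -/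
abbrev L2R : Type := Lp ℂ 2 (volume : Measure ℝ)

/-- `φ` is the weak derivative of `ψ` on the punctured line: the test functions are the smooth
functions with compact support inside `ℝ ∖ {0}`. -/
def HasWeakDerivOffZero (ψ φ : L2R) : Prop :=
  ∀ η : ℝ → ℝ, ContDiff ℝ ∞ η → HasCompactSupport η → tsupport η ⊆ {0}ᶜ →
    ∫ x, deriv η x • ψ x = -∫ x, η x • φ x

/-- `ψ(-0) = a`, as an essential limit. For a function with a weak derivative in `L2` off zero
it is the left limit at zero of the continuous representative. -/
def HasLeftValue (ψ : L2R) (a : ℂ) : Prop :=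
  Tendsto ψ (𝓝[<] (0 : ℝ) ⊓ ae volume) (𝓝 a)

/-- `ψ(+0) = b`, as an essential limit. -/
def HasRightValue (ψ : L2R) (b : ℂ) : Prop :=
  Tendsto ψ (𝓝[>] (0 : ℝ) ⊓ ae volume) (𝓝 b)

/-- The graph relation of the operator `A(v, α)`: `ψ` lies in the Sobolev space of the punctured
line (weak derivative `φ` in `L2`), has the one-sided values `a = ψ(-0)`, `b = ψ(+0)`, satisfies
the boundary condition `i a - i e^{-iα} b = ⟨ψ, v⟩`, and `χ = i φ + ((a + e^{-iα} b) / 2) v`.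
(`inner ℂ v ψ` is `∫ ψ conj v`, linear in `ψ`.) -/
def MomentumRel (v : L2R) (α : ℝ) (ψ χ : L2R) : Prop :=
  ∃ (φ : L2R) (a b : ℂ), HasWeakDerivOffZero ψ φ ∧ HasLeftValue ψ a ∧ HasRightValue ψ b ∧
    I * a - I * exp (-(I * α)) * b = inner ℂ v ψ ∧
    χ = I • φ + ((a + exp (-(I * α)) * b) / 2) • v

theorem integrable_smul_L2R {η : ℝ → ℝ} (hη : Continuous η) (hc : HasCompactSupport η)
    (ψ : L2R) : Integrable fun x => η x • ψ x := by
  have h := ((Lp.memLp ψ).locallyIntegrable (by norm_num)).integrable_smul_left_of_hasCompactSupport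
    hη hc
  exact h

theorem HasWeakDerivOffZero.add {ψ φ ψ' φ' : L2R} (h : HasWeakDerivOffZero ψ φ)
    (h' : HasWeakDerivOffZero ψ' φ') : HasWeakDerivOffZero (ψ + ψ') (φ + φ') := by
  intro η h1 h2 h3
  have e1 : ∫ x, deriv η x • (ψ + ψ') x = ∫ x, (deriv η x • ψ x + deriv η x • ψ' x) := by
    refine integral_congr_ae ?_
    filter_upwards [Lp.coeFn_add ψ ψ'] with x hx
    rw [hx, Pi.add_apply, smul_add]
  have e2 : ∫ x, η x • (φ + φ') x = ∫ x, (η x • φ x + η x • φ' x) := by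
    refine integral_congr_ae ?_
    filter_upwards [Lp.coeFn_add φ φ'] with x hx
    rw [hx, Pi.add_apply, smul_add]
  have hd : Continuous (deriv η) := h1.continuous_deriv (by simp)
  rw [e1, e2, integral_add (integrable_smul_L2R hd h2.deriv _) (integrable_smul_L2R hd h2.deriv _),
    integral_add (integrable_smul_L2R h1.continuous h2 _) (integrable_smul_L2R h1.continuous h2 _),
    h η h1 h2 h3, h' η h1 h2 h3, neg_add]

theorem HasWeakDerivOffZero.smul {ψ φ : L2R} (c : ℂ) (h : HasWeakDerivOffZero ψ φ) :
    HasWeakDerivOffZero (c • ψ) (c • φ) := by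
  intro η h1 h2 h3
  have e1 : ∫ x, deriv η x • (c • ψ) x = ∫ x, c • (deriv η x • ψ x) := by
    refine integral_congr_ae ?_
    filter_upwards [Lp.coeFn_smul c ψ] with x hx
    rw [hx, Pi.smul_apply, smul_comm]
  have e2 : ∫ x, η x • (c • φ) x = ∫ x, c • (η x • φ x) := by
    refine integral_congr_ae ?_
    filter_upwards [Lp.coeFn_smul c φ] with x hx
    rw [hx, Pi.smul_apply, smul_comm]
  rw [e1, e2, integral_smul, integral_smul, h η h1 h2 h3, smul_neg]

theorem HasWeakDerivOffZero.eq_zero {φ : L2R} (h : HasWeakDerivOffZero 0 φ) : φ = 0 := by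
  have key : ∀ᵐ x ∂(volume : Measure ℝ), x ∈ ({0}ᶜ : Set ℝ) → φ x = 0 := by
    refine isOpen_compl_singleton.ae_eq_zero_of_integral_contDiff_smul_eq_zero
      (((Lp.memLp φ).locallyIntegrable (by norm_num)).locallyIntegrableOn _) ?_
    intro η h1 h2 h3
    have e : ∫ x, deriv η x • (0 : L2R) x = 0 := by
      rw [← integral_zero ℝ ℂ]
      refine integral_congr_ae ?_
      filter_upwards [Lp.coeFn_zero ℂ 2 (volume : Measure ℝ)] with x hx
      rw [hx, Pi.zero_apply, smul_zero]
    have := h η h1 h2 h3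
    rw [e] at this
    exact neg_eq_zero.mp this.symm
  refine (Lp.eq_zero_iff_ae_eq_zero).2 ?_
  filter_upwards [key, compl_mem_ae_iff.2 (measure_singleton (0 : ℝ))] with x hx h0
  exact hx h0

theorem neBot_left : (𝓝[<] (0 : ℝ) ⊓ ae (volume : Measure ℝ)).NeBot := by
  rw [inf_neBot_iff]
  intro s hs t ht
  obtain ⟨l, hl, hls⟩ := (mem_nhdsLT_iff_exists_Ioo_subset).1 hs
  have hpos : volume (Set.Ioo l 0 ∩ t) ≠ 0 := by
    rw [measure_inter_conull (mem_ae_iff.1 ht)]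
    simpa using hl
  obtain ⟨x, hx⟩ := nonempty_of_measure_ne_zero hpos
  exact ⟨x, hls hx.1, hx.2⟩

theorem neBot_right : (𝓝[>] (0 : ℝ) ⊓ ae (volume : Measure ℝ)).NeBot := by
  rw [inf_neBot_iff]
  intro s hs t ht
  obtain ⟨l, hl, hls⟩ := (mem_nhdsGT_iff_exists_Ioo_subset).1 hs
  have hpos : volume (Set.Ioo 0 l ∩ t) ≠ 0 := by
    rw [measure_inter_conull (mem_ae_iff.1 ht)]
    simpa using hl
  obtain ⟨x, hx⟩ := nonempty_of_measure_ne_zero hpos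
  exact ⟨x, hls hx.1, hx.2⟩

theorem tendsto_L2R_add {l : Filter ℝ} {ψ ψ' : L2R} {a a' : ℂ}
    (h : Tendsto ψ (l ⊓ ae volume) (𝓝 a)) (h' : Tendsto ψ' (l ⊓ ae volume) (𝓝 a')) :
    Tendsto (ψ + ψ' : L2R) (l ⊓ ae volume) (𝓝 (a + a')) := by
  refine (h.add h').congr' ?_
  exact (Lp.coeFn_add ψ ψ').symm.filter_mono inf_le_right

theorem tendsto_L2R_smul {l : Filter ℝ} {ψ : L2R} {a : ℂ} (c : ℂ)
    (h : Tendsto ψ (l ⊓ ae volume) (𝓝 a)) :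
    Tendsto (c • ψ : L2R) (l ⊓ ae volume) (𝓝 (c * a)) := by
  refine (h.const_mul c).congr' ?_
  exact (Lp.coeFn_smul c ψ).symm.filter_mono inf_le_right

theorem tendsto_L2R_zero (l : Filter ℝ) : Tendsto (0 : L2R) (l ⊓ ae volume) (𝓝 (0 : ℂ)) := by
  refine (tendsto_const_nhds (x := (0 : ℂ))).congr' ?_
  exact (Lp.coeFn_zero ℂ 2 (volume : Measure ℝ)).symm.filter_mono inf_le_right

/-- The graph of `A(v, α)` as a subspace of `L2 × L2`. -/
def momentumGraph (v : L2R) (α : ℝ) : Submodule ℂ (L2R × L2R) where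
  carrier := {p | MomentumRel v α p.1 p.2}
  add_mem' := by
    rintro ⟨ψ, χ⟩ ⟨ψ', χ'⟩ ⟨φ, a, b, h1, h2, h3, h4, h5⟩ ⟨φ', a', b', h1', h2', h3', h4', h5'⟩
    refine ⟨φ + φ', a + a', b + b', h1.add h1', tendsto_L2R_add h2 h2', tendsto_L2R_add h3 h3',
      ?_, ?_⟩
    · simp only [Prod.fst_add, inner_add_right]
      rw [← h4, ← h4']; ring
    · simp only [Prod.snd_add]
      simp only at h5 h5'
      rw [h5, h5']; module
  zero_mem' := by
    refine ⟨0, 0, 0, ?_, tendsto_L2R_zero _, tendsto_L2R_zero _, ?_, ?_⟩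
    · have hz : HasWeakDerivOffZero 0 0 := by
        intro η _ _ _
        have e : ∀ f : ℝ → ℝ, ∫ x, f x • (0 : L2R) x = 0 := by
          intro f
          rw [← integral_zero ℝ ℂ]
          refine integral_congr_ae ?_
          filter_upwards [Lp.coeFn_zero ℂ 2 (volume : Measure ℝ)] with x hx
          rw [hx, Pi.zero_apply, smul_zero]
        rw [e, e, neg_zero]
      exact hz
    · simp
    · simp
  smul_mem' := by
    rintro c ⟨ψ, χ⟩ ⟨φ, a, b, h1, h2, h3, h4, h5⟩
    refine ⟨c • φ, c * a, c * b, h1.smul c, tendsto_L2R_smul c h2, tendsto_L2R_smul c h3, ?_, ?_⟩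
    · simp only [Prod.smul_fst, inner_smul_right]
      rw [← h4]; ring
    · simp only [Prod.smul_snd]
      simp only at h5
      rw [h5]; module

theorem momentumGraph_singleValued (v : L2R) (α : ℝ) :
    ∀ p ∈ momentumGraph v α, p.1 = 0 → p.2 = 0 := by
  rintro ⟨ψ, χ⟩ ⟨φ, a, b, h1, h2, h3, -, h5⟩ h0
  simp only at h0 h1 h2 h3 h5 ⊢
  subst h0
  have := neBot_left
  have := neBot_right
  have ha : a = 0 := tendsto_nhds_unique h2 (tendsto_L2R_zero _)
  have hb : b = 0 := tendsto_nhds_unique h3 (tendsto_L2R_zero _)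
  rw [h5, h1.eq_zero, ha, hb]
  simp

/-- The operator `A(v, α)`: `ψ ↦ i ψ' + v (ψ(-0) + e^{-iα} ψ(+0)) / 2`, on the functions of the
Sobolev space of the punctured line with `i ψ(-0) - i e^{-iα} ψ(+0) = ⟨ψ, v⟩`. -/
def momentumOp (v : L2R) (α : ℝ) : L2R →ₗ.[ℂ] L2R := (momentumGraph v α).toLinearPMap

theorem mem_momentumOp_graph (v : L2R) (α : ℝ) (ψ χ : L2R) :
    (ψ, χ) ∈ (momentumOp v α).graph ↔ MomentumRel v α ψ χ := by
  rw [momentumOp, Submodule.toLinearPMap_graph_eq _ (momentumGraph_singleValued v α)]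
  rfl

/-- `R` is the resolvent `(A - z)⁻¹`: the bounded, everywhere defined two-sided inverse. -/
def IsResolvent (A : L2R →ₗ.[ℂ] L2R) (z : ℂ) (R : L2R →L[ℂ] L2R) : Prop :=
  (∀ h : L2R, ∃ hd : R h ∈ A.domain, A ⟨R h, hd⟩ - z • R h = h) ∧
    ∀ ψ : A.domain, R (A ψ - z • (ψ : L2R)) = ψ

/-- `R` is the integral operator with kernel `K`. -/
def HasKernel (R : L2R →L[ℂ] L2R) (K : ℝ → ℝ → ℂ) : Prop :=
  ∀ h : L2R, (∀ x, Integrable fun y => K x y * h y) ∧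
    R h =ᵐ[volume] fun x => ∫ y, K x y * h y

/-- `⟨f, g⟩ = ∫ f conj g`, linear in the first argument. -/
def pairing (f g : ℝ → ℂ) : ℂ := ∫ x, f x * conj (g x)

/-- The Heaviside function. -/
def heaviside (t : ℝ) : ℂ := if 0 < t then 1 else 0

/-- The sign of the imaginary part. -/
def sgnIm (z : ℂ) : ℂ := (Real.sign z.im : ℂ)

/-- The Green function of `i d/dx` on the line:
`g_z(x) = i sign(Im z) θ(-x Im z) e^{-izx}`. -/
def freeGreen (z : ℂ) (x : ℝ) : ℂ :=
  I * sgnIm z * heaviside (-x * z.im) * exp (-(I * z * x))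

/-- `β(z, α) = i (1 - e^{-iα}) θ(Im z) + i (e^{iα} - 1) θ(-Im z)`. -/
def betaCoeff (α : ℝ) (z : ℂ) : ℂ :=
  I * (1 - exp (-(I * α))) * heaviside z.im + I * (exp (I * α) - 1) * heaviside (-z.im)

/-- The Green function of the point interaction,
`𝒢_z(x, y; α) = g_z(x - y) + g_z(x) β(z, α) conj g_{conj z}(y)`. -/
def pointGreen (α : ℝ) (z : ℂ) (x y : ℝ) : ℂ :=
  freeGreen z (x - y) + freeGreen z x * betaCoeff α z * conj (freeGreen (conj z) y)

/-- `E₁(x, z) = 𝒢_z(x, -0; α)` (index `0`) and `E₂(x, z) = ∫ 𝒢_z(x, y; α) v(y) dy`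
(index `1`). -/
def pointE (v : L2R) (α : ℝ) (z : ℂ) : Fin 2 → ℝ → ℂ :=
  ![fun x => Function.leftLim (fun y => pointGreen α z x y) 0,
    fun x => ∫ y, pointGreen α z x y * v y]

/-- The matrix `Γ(z)` relative to the point-interaction Green function. -/
def pointGamma (v : L2R) (α : ℝ) (z : ℂ) : Matrix (Fin 2) (Fin 2) ℂ :=
  !![-pairing (pointE v α z 1) v, 1 + pairing v (pointE v α (conj z) 0);
     1 + pairing (pointE v α z 0) v, -(I / 2) * sgnIm z]

/-- `𝒢_z(x, y; v, α) = 𝒢_z(x, y; α) + γ(z)⁻¹ ∑ E_j(x, z) γ_{jk}(z) conj E_k(y, conj z)`. -/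
def nonlocalGreen (v : L2R) (α : ℝ) (z : ℂ) (x y : ℝ) : ℂ :=
  pointGreen α z x y + 1 / (pointGamma v α z).det *
    ∑ j, ∑ k, pointE v α z j x * pointGamma v α z j k * conj (pointE v α (conj z) k y)

/-- `e₁(x, z) = g_z(x)` (index `0`) and `e₂(x, z) = ∫ g_z(x - y) v(y) dy` (index `1`). -/
def freeE (v : L2R) (z : ℂ) : Fin 2 → ℝ → ℂ :=
  ![freeGreen z, fun x => ∫ y, freeGreen z (x - y) * v y]

/-- The matrix `Γ(z)` relative to the free Green function; meaningful for `e^{iα} ≠ -1`. -/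
def freeGamma (v : L2R) (α : ℝ) (z : ℂ) : Matrix (Fin 2) (Fin 2) ℂ :=
  !![pairing (freeE v z 1) v - 2 * I * (1 - exp (I * α)) / (1 + exp (I * α)),
     -(2 / (1 + exp (-(I * α)))) - pairing v (freeGreen (conj z));
     -(2 / (1 + exp (I * α))) - pairing (freeGreen z) v,
     I / (1 + exp (-(I * α))) * (heaviside z.im - exp (-(I * α)) * heaviside (-z.im))]

/-- `g_z(x - y) - ∑ e_j(x, z) c_{jk} conj e_k(y, conj z)`: the free kernel perturbed by a kernel
of rank at most two. -/
def perturbedFreeGreen (v : L2R) (z : ℂ) (c : Matrix (Fin 2) (Fin 2) ℂ) (x y : ℝ) : ℂ :=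
  freeGreen z (x - y) - ∑ j, ∑ k, freeE v z j x * c j k * conj (freeE v (conj z) k y)

end

noncomputable section

open scoped ENNReal

/-! ### Convolution with an integrable kernel on `L2` -/

/-! Convolution with `freeGreen z` is the resolvent of `i d/dx` on the whole line, and everything is
reduced to it. If `ψ` has a weak derivative `φ` off zero and one-sided values `a`, `b`, then `ψ`
equals this resolvent applied to `iφ - zψ` plus `i(b - a) g_z` (`eq_freeOp_add`). Indeed the
difference of the two sides solves the homogeneous equation without a jump, so it is one exponential
on both half-lines, and it is not square integrable unless it vanishes. Using the representation at
`i` and `-i`, where the two free resolvents are adjoint to each other, gives integration by parts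
(`inner_weakDeriv_sub`), and hence the symmetry of `A(v, α)`.

The equation `(A - z)ψ = h` becomes `ψ = freeOp (h - t v) + c g_z` with `t` the mean `(a + e^{-iα}
b)/2`. The unknowns are `t` and `s = ⟨ψ, v⟩`, which determine `c`; the boundary condition and the
definition of `t` are two linear equations for them (`boundary_equations`), whose coefficients are,
up to sign and order, the entries of `pointGamma`. A vanishing determinant would give a nonzero
eigenfunction with nonreal eigenvalue, which symmetry excludes (`det_pointGamma_ne_zero`). Cramer's
rule then gives an explicit finite-rank correction of the free resolvent
(`momentumRel_perturbedFreeOp`), so `A - z` is onto for every nonreal `z`. Symmetry supplies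
injectivity, and together with surjectivity at `±i` also density of the domain and self-adjointness.

The kernel identities are algebra: off zero `E₁` is a multiple of `g_z`, and `E₂` is `e₂` plus a
multiple of `g_z`. Substitution gives the coefficients `resolventCoeff` relative to the free kernel,
and these are `freeGamma` divided by its determinant when `e^{iα} ≠ -1`. -/

/-- Young's inequality for `L1 * L2`: split `K` as `K^{1/2} K^{1/2}`, apply Cauchy-Schwarz for each
`x`, then Tonelli and translation invariance. -/
theorem lintegral_conv_sq_le {K H : ℝ → ℝ≥0∞} (hK : Measurable K) (hH : AEMeasurable H) :
    ∫⁻ x, (∫⁻ y, K (x - y) * H y) ^ 2 ≤ (∫⁻ x, K x) ^ 2 * ∫⁻ y, H y ^ 2 := by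
  have hKx : ∀ x : ℝ, Measurable fun y => K (x - y) := fun x =>
    hK.comp (measurable_const.sub measurable_id)
  have cs : ∀ x : ℝ, (∫⁻ y, K (x - y) * H y) ^ 2 ≤
      (∫⁻ y, K y) * ∫⁻ y, K (x - y) * H y ^ 2 := by
    intro x
    have h := ENNReal.lintegral_mul_le_Lp_mul_Lq (volume : Measure ℝ) Real.HolderConjugate.two_two
      (f := fun y => K (x - y) ^ (1 / 2 : ℝ)) (g := fun y => K (x - y) ^ (1 / 2 : ℝ) * H y)
      ((hKx x).pow_const _).aemeasurable (((hKx x).pow_const _).aemeasurable.mul hH)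
    have e0 : ∀ y, K (x - y) ^ (1 / 2 : ℝ) * K (x - y) ^ (1 / 2 : ℝ) = K (x - y) := by
      intro y
      rw [← ENNReal.rpow_add_of_nonneg _ _ (by norm_num) (by norm_num)]
      norm_num
    have e1 : ∀ y, ((fun y => K (x - y) ^ (1 / 2 : ℝ)) *
        fun y => K (x - y) ^ (1 / 2 : ℝ) * H y) y = K (x - y) * H y := by
      intro y
      simp only [Pi.mul_apply]
      rw [← mul_assoc, e0]
    have e2 : ∀ y, (K (x - y) ^ (1 / 2 : ℝ)) ^ (2 : ℝ) = K (x - y) := by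
      intro y
      rw [← ENNReal.rpow_mul]; norm_num
    have e3 : ∀ y, (K (x - y) ^ (1 / 2 : ℝ) * H y) ^ (2 : ℝ) = K (x - y) * H y ^ 2 := by
      intro y
      rw [ENNReal.mul_rpow_of_nonneg _ _ (by norm_num), e2]
      norm_num
    simp only [e1, e2, e3] at h
    have h2 := pow_le_pow_left₀ zero_le h 2
    refine h2.trans_eq ?_
    rw [mul_pow, lintegral_sub_left_eq_self (fun y => K y) x]
    have e4 : ∀ t : ℝ≥0∞, (t ^ (1 / 2 : ℝ)) ^ 2 = t := by
      intro t
      rw [← ENNReal.rpow_natCast, ← ENNReal.rpow_mul]; norm_num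
    rw [e4, e4]
  have hm : AEMeasurable (Function.uncurry fun x y : ℝ => K (x - y) * H y ^ 2)
      ((volume : Measure ℝ).prod volume) :=
    (hK.comp (measurable_fst.sub measurable_snd)).aemeasurable.mul ((hH.comp_snd).pow_const 2)
  have hme : AEMeasurable (fun x => ∫⁻ y, K (x - y) * H y ^ 2) (volume : Measure ℝ) :=
    hm.lintegral_prod_right'
  calc ∫⁻ x, (∫⁻ y, K (x - y) * H y) ^ 2
      ≤ ∫⁻ x, (∫⁻ y, K y) * ∫⁻ y, K (x - y) * H y ^ 2 := lintegral_mono cs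
    _ = (∫⁻ y, K y) * ∫⁻ x, ∫⁻ y, K (x - y) * H y ^ 2 := lintegral_const_mul'' _ hme
    _ = (∫⁻ y, K y) * ∫⁻ y, ∫⁻ x, K (x - y) * H y ^ 2 := by rw [lintegral_lintegral_swap hm]
    _ = (∫⁻ y, K y) * ∫⁻ y, (∫⁻ x, K x) * H y ^ 2 := by
        congr 1
        refine lintegral_congr fun y => ?_
        have hy : Measurable fun x => K (x - y) := hK.comp (measurable_id.sub measurable_const)
        rw [lintegral_mul_const _ hy, lintegral_sub_right_eq_self (fun x => K x) y]
    _ = (∫⁻ x, K x) ^ 2 * ∫⁻ y, H y ^ 2 := by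
        rw [lintegral_const_mul'' _ (hH.pow_const 2), sq, mul_assoc]

theorem eLpNorm_two_eq {f : ℝ → ℂ} :
    eLpNorm f 2 volume = (∫⁻ x, ‖f x‖ₑ ^ 2) ^ (1 / 2 : ℝ) := by
  rw [eLpNorm_eq_lintegral_rpow_enorm_toReal (by norm_num) (by norm_num)]
  norm_num

theorem aestronglyMeasurable_conv_integrand {K h : ℝ → ℂ} (hK : Measurable K)
    (hh : AEStronglyMeasurable h volume) :
    AEStronglyMeasurable (Function.uncurry fun x y : ℝ => K (x - y) * h y)
      ((volume : Measure ℝ).prod volume) :=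
  (hK.comp (measurable_fst.sub measurable_snd)).aestronglyMeasurable.mul hh.comp_snd

theorem aestronglyMeasurable_conv {K h : ℝ → ℂ} (hK : Measurable K)
    (hh : AEStronglyMeasurable h volume) :
    AEStronglyMeasurable (fun x => ∫ y, K (x - y) * h y) volume :=
  (aestronglyMeasurable_conv_integrand hK hh).integral_prod_right'

theorem eLpNorm_conv_le {K h : ℝ → ℂ} (hK : Measurable K) (hh : AEStronglyMeasurable h volume) :
    eLpNorm (fun x => ∫ y, K (x - y) * h y) 2 volume ≤
      (∫⁻ x, ‖K x‖ₑ) * eLpNorm h 2 volume := by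
  rw [eLpNorm_two_eq, eLpNorm_two_eq]
  have h1 : ∫⁻ x, ‖∫ y, K (x - y) * h y‖ₑ ^ 2 ≤ (∫⁻ x, ‖K x‖ₑ) ^ 2 * ∫⁻ y, ‖h y‖ₑ ^ 2 := by
    refine le_trans (lintegral_mono fun x => ?_)
      (lintegral_conv_sq_le (K := fun x => ‖K x‖ₑ) (H := fun x => ‖h x‖ₑ) hK.enorm hh.enorm)
    refine pow_le_pow_left₀ zero_le ?_ 2
    refine (enorm_integral_le_lintegral_enorm _).trans_eq ?_
    simp only [enorm_mul]
  refine (ENNReal.rpow_le_rpow h1 (by norm_num)).trans_eq ?_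
  rw [ENNReal.mul_rpow_of_nonneg _ _ (by norm_num)]
  congr 1
  rw [← ENNReal.rpow_natCast, ← ENNReal.rpow_mul]
  norm_num

theorem memLp_conv {K h : ℝ → ℂ} (hK : Measurable K) (hKi : Integrable K)
    (hh : MemLp h 2 volume) : MemLp (fun x => ∫ y, K (x - y) * h y) 2 volume :=
  ⟨aestronglyMeasurable_conv hK hh.1, (eLpNorm_conv_le hK hh.1).trans_lt
    (ENNReal.mul_lt_top hKi.2 hh.2)⟩

/-- The hypothesis of Fubini for moving a convolution across a pairing: Cauchy-Schwarz between `|k|`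
and `|K| * |h|`, the latter being in `L2` by the convolution bound. -/
theorem integrable_prod_conv {K h k : ℝ → ℂ} (hK : Measurable K) (hKi : Integrable K)
    (hh : MemLp h 2 volume) (hk : MemLp k 2 volume) :
    Integrable (Function.uncurry fun x y : ℝ => k x * (K (x - y) * h y))
      ((volume : Measure ℝ).prod volume) := by
  have hm0 : AEStronglyMeasurable (Function.uncurry fun x y : ℝ => k x * (K (x - y) * h y))
      ((volume : Measure ℝ).prod volume) :=
    hk.1.comp_fst.mul (aestronglyMeasurable_conv_integrand hK hh.1)
  refine ⟨hm0, ?_⟩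
  have hm : AEMeasurable (Function.uncurry fun x y : ℝ => ‖K (x - y)‖ₑ * ‖h y‖ₑ)
      ((volume : Measure ℝ).prod volume) := by
    have := (aestronglyMeasurable_conv_integrand hK hh.1).enorm
    refine this.congr (ae_of_all _ fun p => ?_)
    simp [Function.uncurry, enorm_mul]
  have hme : AEMeasurable (fun x => ∫⁻ y, ‖K (x - y)‖ₑ * ‖h y‖ₑ) (volume : Measure ℝ) :=
    hm.lintegral_prod_right'
  rw [HasFiniteIntegral, lintegral_prod _ hm0.enorm]
  have e : ∀ x, ∫⁻ y, ‖Function.uncurry (fun x y : ℝ => k x * (K (x - y) * h y)) (x, y)‖ₑ =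
      ‖k x‖ₑ * ∫⁻ y, ‖K (x - y)‖ₑ * ‖h y‖ₑ := by
    intro x
    simp only [Function.uncurry, enorm_mul]
    rw [lintegral_const_mul' _ _ enorm_ne_top]
  simp only [e]
  have hs := ENNReal.lintegral_mul_le_Lp_mul_Lq (volume : Measure ℝ) Real.HolderConjugate.two_two
    hk.1.enorm hme
  refine hs.trans_lt (ENNReal.mul_lt_top ?_ ?_)
  · have := hk.2
    rw [eLpNorm_two_eq] at this
    simpa using this
  · refine ENNReal.rpow_lt_top_of_nonneg (by norm_num) (ne_of_lt ?_)
    have h2 : ∫⁻ y, ‖h y‖ₑ ^ 2 < ⊤ := by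
      have := hh.2
      rw [eLpNorm_two_eq] at this
      by_contra hc
      rw [not_lt, top_le_iff] at hc
      rw [hc] at this
      norm_num at this
    have := (lintegral_conv_sq_le (K := fun x => ‖K x‖ₑ) (H := fun x => ‖h x‖ₑ) hK.enorm
      hh.1.enorm).trans_lt (ENNReal.mul_lt_top (ENNReal.pow_lt_top hKi.2) h2)
    simpa using this

theorem integral_conv_swap {K h k : ℝ → ℂ} (hK : Measurable K) (hKi : Integrable K)
    (hh : MemLp h 2 volume) (hk : MemLp k 2 volume) :
    ∫ x, k x * ∫ y, K (x - y) * h y = ∫ y, h y * ∫ x, K (x - y) * k x := by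
  have hsw := integral_integral_swap (integrable_prod_conv hK hKi hh hk)
  simp only [integral_const_mul] at hsw
  rw [hsw]
  refine integral_congr_ae (ae_of_all _ fun y => ?_)
  simp only
  rw [← integral_const_mul]
  refine integral_congr_ae (ae_of_all _ fun x => ?_)
  simp only
  ring

/-! ### The free Green function -/

theorem sgnIm_conj (z : ℂ) : sgnIm (conj z) = -sgnIm z := by
  simp [sgnIm, Real.sign_neg]

theorem conj_sgnIm (z : ℂ) : conj (sgnIm z) = sgnIm z := by
  simp [sgnIm]

theorem conj_heaviside (t : ℝ) : conj (heaviside t) = heaviside t := by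
  unfold heaviside; split_ifs <;> simp

/-- This reflection is why the adjoint of the free resolvent at `z` is the one at `conj z`, and why
the second factor in every kernel is a conjugate taken at `conj z`. -/
theorem conj_freeGreen_conj (z : ℂ) (y : ℝ) :
    conj (freeGreen (conj z) y) = freeGreen z (-y) := by
  simp only [freeGreen, map_mul, conj_I, conj_sgnIm, conj_heaviside, sgnIm_conj, ← exp_conj,
    map_neg, conj_conj, conj_ofReal, conj_im, mul_neg, neg_neg, neg_mul, ofReal_neg]

theorem norm_sgnIm_le (z : ℂ) : ‖sgnIm z‖ ≤ 1 := by
  rw [sgnIm, norm_real]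
  rcases Real.sign_apply_eq z.im with h | h | h <;> simp [h]

theorem norm_freeGreen_le (z : ℂ) (x : ℝ) :
    ‖freeGreen z x‖ ≤ Real.exp (-(|z.im| * |x|)) := by
  by_cases h : 0 < -x * z.im
  · have e : (-(I * z * x)).re = -(|z.im| * |x|) := by
      have : |z.im| * |x| = -x * z.im := by
        rw [← abs_mul, ← abs_of_pos h, mul_comm, neg_mul, abs_neg]
      rw [this]
      simp [mul_comm]
    simp only [freeGreen, heaviside, if_pos h, mul_one, norm_mul, norm_I, one_mul, norm_exp, e]
    exact mul_le_of_le_one_left (Real.exp_pos _).le (norm_sgnIm_le z)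
  · simp only [freeGreen, heaviside, if_neg h, mul_zero, zero_mul, norm_zero]
    positivity

theorem measurable_heaviside : Measurable heaviside :=
  Measurable.ite measurableSet_Ioi measurable_const measurable_const

theorem measurable_freeGreen (z : ℂ) : Measurable (freeGreen z) := by
  unfold freeGreen
  exact (measurable_const.mul (measurable_heaviside.comp (by fun_prop))).mul (by fun_prop)

theorem integrable_exp_neg_mul_abs {c : ℝ} (hc : 0 < c) :
    Integrable fun x : ℝ => Real.exp (-(c * |x|)) := by
  rw [← integrableOn_univ, ← Set.Iic_union_Ioi (a := (0 : ℝ)), integrableOn_union]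
  constructor
  · refine (integrableOn_exp_mul_Iic hc 0).congr_fun (fun x hx => ?_) measurableSet_Iic
    simp only
    rw [abs_of_nonpos hx]; ring_nf
  · refine (integrableOn_exp_mul_Ioi (neg_lt_zero.2 hc) 0).congr_fun (fun x hx => ?_)
      measurableSet_Ioi
    simp only
    rw [abs_of_pos hx]; ring_nf

theorem memLp_exp_neg_mul_abs {c : ℝ} (hc : 0 < c) :
    MemLp (fun x : ℝ => Real.exp (-(c * |x|))) 2 volume := by
  rw [memLp_two_iff_integrable_sq (by fun_prop)]
  refine (integrable_exp_neg_mul_abs (c := 2 * c) (by positivity)).congr (ae_of_all _ fun x => ?_)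
  simp only
  rw [← Real.exp_nat_mul]
  ring_nf

theorem integrable_freeGreen {z : ℂ} (hz : z.im ≠ 0) : Integrable (freeGreen z) :=
  (integrable_exp_neg_mul_abs (abs_pos.2 hz)).mono' (measurable_freeGreen z).aestronglyMeasurable
    (ae_of_all _ (norm_freeGreen_le z))

theorem memLp_freeGreen {z : ℂ} (hz : z.im ≠ 0) : MemLp (freeGreen z) 2 volume :=
  (memLp_exp_neg_mul_abs (abs_pos.2 hz)).of_le (measurable_freeGreen z).aestronglyMeasurable
    (ae_of_all _ fun x => by
      rw [Real.norm_of_nonneg (Real.exp_pos _).le]; exact norm_freeGreen_le z x)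

theorem memLp_freeGreen_sub {z : ℂ} (hz : z.im ≠ 0) (x : ℝ) :
    MemLp (fun y => freeGreen z (x - y)) 2 volume :=
  (memLp_freeGreen hz).comp_measurePreserving (Measure.measurePreserving_sub_left volume x)

theorem integrable_freeGreen_mul {z : ℂ} (hz : z.im ≠ 0) (x : ℝ) {h : ℝ → ℂ}
    (hh : MemLp h 2 volume) : Integrable fun y => freeGreen z (x - y) * h y :=
  (memLp_freeGreen_sub hz x).integrable_mul hh

theorem freeGreen_of_im_pos {z : ℂ} (hz : 0 < z.im) (x : ℝ) :
    freeGreen z x = if x < 0 then I * exp (-(I * z * x)) else 0 := by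
  have h : 0 < -x * z.im ↔ x < 0 := by rw [mul_pos_iff_of_pos_right hz, neg_pos]
  simp only [freeGreen, heaviside, h, sgnIm, Real.sign_of_pos hz]
  split_ifs <;> simp

theorem freeGreen_of_im_neg {z : ℂ} (hz : z.im < 0) (x : ℝ) :
    freeGreen z x = if 0 < x then -I * exp (-(I * z * x)) else 0 := by
  have h : 0 < -x * z.im ↔ 0 < x := by rw [neg_mul_comm, mul_pos_iff_of_pos_right (neg_pos.2 hz)]
  simp only [freeGreen, heaviside, h, sgnIm, Real.sign_of_neg hz]
  split_ifs <;> simp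

theorem tendsto_exp_nhds_zero (z : ℂ) (l : Filter ℝ) (hl : l ≤ 𝓝 0) (c : ℂ) :
    Tendsto (fun x : ℝ => c * exp (-(I * z * x))) l (𝓝 c) := by
  have : Continuous fun x : ℝ => c * exp (-(I * z * x)) := by fun_prop
  have h := this.tendsto 0
  simp only [ofReal_zero, mul_zero, neg_zero, Complex.exp_zero, mul_one] at h
  exact h.mono_left hl

theorem tendsto_freeGreen_left {z : ℂ} (hz : z.im ≠ 0) :
    Tendsto (freeGreen z) (𝓝[<] 0) (𝓝 (I * heaviside z.im)) := by
  rcases lt_or_gt_of_ne hz with h | h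
  · have e : heaviside z.im = 0 := if_neg h.not_gt
    rw [e, mul_zero]
    refine tendsto_const_nhds.congr' ?_
    filter_upwards [self_mem_nhdsWithin] with x hx
    rw [freeGreen_of_im_neg h, if_neg (not_lt.2 (le_of_lt hx))]
  · have e : heaviside z.im = 1 := if_pos h
    rw [e, mul_one]
    refine (tendsto_exp_nhds_zero z _ nhdsWithin_le_nhds I).congr' ?_
    filter_upwards [self_mem_nhdsWithin] with x hx
    rw [freeGreen_of_im_pos h, if_pos (by exact hx)]

theorem tendsto_freeGreen_right {z : ℂ} (hz : z.im ≠ 0) :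
    Tendsto (freeGreen z) (𝓝[>] 0) (𝓝 (-I * heaviside (-z.im))) := by
  rcases lt_or_gt_of_ne hz with h | h
  · have e : heaviside (-z.im) = 1 := if_pos (neg_pos.2 h)
    rw [e, mul_one]
    refine (tendsto_exp_nhds_zero z _ nhdsWithin_le_nhds (-I)).congr' ?_
    filter_upwards [self_mem_nhdsWithin] with x hx
    rw [freeGreen_of_im_neg h, if_pos (by exact hx)]
  · have e : heaviside (-z.im) = 0 := if_neg (by linarith)
    rw [e, mul_zero]
    refine tendsto_const_nhds.congr' ?_
    filter_upwards [self_mem_nhdsWithin] with x hx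
    rw [freeGreen_of_im_pos h, if_neg (not_lt.2 (le_of_lt hx))]

theorem continuousAt_freeGreen (z : ℂ) {x : ℝ} (hx : x ≠ 0) : ContinuousAt (freeGreen z) x := by
  by_cases hz : z.im = 0
  · have : freeGreen z = fun _ => 0 := by
      funext y; simp [freeGreen, heaviside, hz]
    rw [this]; exact continuousAt_const
  have hc : ContinuousAt (fun y : ℝ => heaviside (-y * z.im)) x := by
    have hne : -x * z.im ≠ 0 := mul_ne_zero (neg_ne_zero.2 hx) hz
    have hcc : Continuous fun y : ℝ => -y * z.im := by fun_prop
    rcases lt_or_gt_of_ne hne with h | h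
    · refine (continuousAt_const (y := (0 : ℂ))).congr ?_
      filter_upwards [hcc.continuousAt.eventually (gt_mem_nhds h)] with y hy
      exact (if_neg hy.not_gt).symm
    · refine (continuousAt_const (y := (1 : ℂ))).congr ?_
      filter_upwards [hcc.continuousAt.eventually (lt_mem_nhds h)] with y hy
      exact (if_pos hy).symm
  unfold freeGreen
  exact (continuousAt_const.mul hc).mul (by fun_prop)

/-- The convolution with the free Green function is continuous at the origin. -/
theorem continuousAt_freeConv {z : ℂ} (hz : z.im ≠ 0) {h : ℝ → ℂ} (hh : MemLp h 2 volume) :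
    ContinuousAt (fun x => ∫ y, freeGreen z (x - y) * h y) 0 := by
  have hpos := abs_pos.2 hz
  -- For `|x| < 1` one has `|x - y| ≥ |y| - 1`, whence the constant `exp |z.im|` in the bound. The
  -- only discontinuity of the integrand at `x = 0` occurs for `y = 0`, a null set.
  refine continuousAt_of_dominated
    (bound := fun y => Real.exp |z.im| * (Real.exp (-(|z.im| * |y|)) * ‖h y‖)) ?_ ?_ ?_ ?_
  · exact Eventually.of_forall fun x => (integrable_freeGreen_mul hz x hh).1
  · filter_upwards [Metric.ball_mem_nhds (0 : ℝ) one_pos] with x hx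
    refine ae_of_all _ fun y => ?_
    rw [norm_mul, ← mul_assoc, ← Real.exp_add]
    refine mul_le_mul_of_nonneg_right ((norm_freeGreen_le z _).trans ?_) (norm_nonneg _)
    rw [Real.exp_le_exp]
    have h1 : |x| < 1 := by simpa using hx
    have h2 : |y| ≤ |x - y| + |x| := by
      have := abs_sub_abs_le_abs_sub y x
      rw [abs_sub_comm] at this
      linarith
    nlinarith
  · exact ((memLp_exp_neg_mul_abs hpos).integrable_mul hh.norm).const_mul _
  · filter_upwards [compl_mem_ae_iff.2 (measure_singleton (0 : ℝ))] with y hy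
    refine ContinuousAt.mul ?_ continuousAt_const
    refine ContinuousAt.comp (g := freeGreen z) (f := fun x : ℝ => x - y) ?_ (by fun_prop)
    exact continuousAt_freeGreen z (by simpa using hy)

/-! ### The free resolvent as a bounded operator and its adjoint -/

theorem inner_L2R_eq (f g : L2R) : inner ℂ f g = ∫ x, g x * conj (f x) := by
  rw [L2.inner_def]
  simp only [RCLike.inner_apply]

/-- The free Green function as an element of `L2`. -/
def freeGreenL (z : ℂ) (hz : z.im ≠ 0) : L2R := (memLp_freeGreen hz).toLp _

theorem coeFn_freeGreenL (z : ℂ) (hz : z.im ≠ 0) : freeGreenL z hz =ᵐ[volume] freeGreen z :=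
  MemLp.coeFn_toLp _

/-- Convolution with the free Green function as a bounded operator: the free resolvent. -/
def freeOp (z : ℂ) (hz : z.im ≠ 0) : L2R →L[ℂ] L2R :=
  LinearMap.mkContinuous
    { toFun := fun h =>
        (memLp_conv (measurable_freeGreen z) (integrable_freeGreen hz) (Lp.memLp h)).toLp _
      map_add' := fun h k => by
        rw [← MemLp.toLp_add]
        refine MemLp.toLp_congr _ _ (ae_of_all _ fun x => ?_)
        simp only [Pi.add_apply]
        rw [← integral_add (integrable_freeGreen_mul hz x (Lp.memLp h))
          (integrable_freeGreen_mul hz x (Lp.memLp k))]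
        refine integral_congr_ae ?_
        filter_upwards [Lp.coeFn_add h k] with y hy
        rw [hy, Pi.add_apply, mul_add]
      map_smul' := fun c h => by
        rw [RingHom.id_apply, ← MemLp.toLp_const_smul]
        refine MemLp.toLp_congr _ _ (ae_of_all _ fun x => ?_)
        simp only [Pi.smul_apply]
        rw [← integral_smul]
        refine integral_congr_ae ?_
        filter_upwards [Lp.coeFn_smul c h] with y hy
        rw [hy, Pi.smul_apply, mul_smul_comm] }
    (∫⁻ x, ‖freeGreen z x‖ₑ).toReal (fun h => by
      simp only [LinearMap.coe_mk, AddHom.coe_mk, Lp.norm_toLp]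
      rw [Lp.norm_def, ← ENNReal.toReal_mul]
      exact ENNReal.toReal_mono
        (ENNReal.mul_lt_top (integrable_freeGreen hz).2 (Lp.memLp h).2).ne
        (eLpNorm_conv_le (measurable_freeGreen z) (Lp.memLp h).1))

theorem coeFn_freeOp (z : ℂ) (hz : z.im ≠ 0) (h : L2R) :
    freeOp z hz h =ᵐ[volume] fun x => ∫ y, freeGreen z (x - y) * h y :=
  MemLp.coeFn_toLp
    (memLp_conv (measurable_freeGreen z) (integrable_freeGreen hz) (Lp.memLp h))

theorem im_conj_ne_zero {z : ℂ} (hz : z.im ≠ 0) : (conj z).im ≠ 0 := by simpa using hz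

theorem integral_freeGreen_neg_mul (z : ℂ) (hz : z.im ≠ 0) (h : L2R) :
    ∫ y, freeGreen z (0 - y) * h y = inner ℂ (freeGreenL (conj z) (im_conj_ne_zero hz)) h := by
  rw [inner_L2R_eq]
  refine integral_congr_ae ?_
  filter_upwards [coeFn_freeGreenL (conj z) (im_conj_ne_zero hz)] with y hy
  rw [hy, conj_freeGreen_conj, zero_sub, mul_comm]

theorem tendsto_freeOp (z : ℂ) (hz : z.im ≠ 0) (h : L2R) {l : Filter ℝ} (hl : l ≤ 𝓝 0) :
    Tendsto (freeOp z hz h) (l ⊓ ae volume)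
      (𝓝 (inner ℂ (freeGreenL (conj z) (im_conj_ne_zero hz)) h)) := by
  have hc := continuousAt_freeConv hz (Lp.memLp h)
  rw [ContinuousAt, integral_freeGreen_neg_mul z hz h] at hc
  refine (hc.mono_left (inf_le_left.trans hl)).congr' ?_
  exact (coeFn_freeOp z hz h).symm.filter_mono inf_le_right

theorem hasLeftValue_freeGreenL (z : ℂ) (hz : z.im ≠ 0) :
    HasLeftValue (freeGreenL z hz) (I * heaviside z.im) :=
  ((tendsto_freeGreen_left hz).mono_left inf_le_left).congr'
    ((coeFn_freeGreenL z hz).symm.filter_mono inf_le_right)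

theorem hasRightValue_freeGreenL (z : ℂ) (hz : z.im ≠ 0) :
    HasRightValue (freeGreenL z hz) (-I * heaviside (-z.im)) :=
  ((tendsto_freeGreen_right hz).mono_left inf_le_left).congr'
    ((coeFn_freeGreenL z hz).symm.filter_mono inf_le_right)

/-- The adjoint of the free resolvent at `z` is the free resolvent at `conj z`. -/
theorem inner_freeOp_left (z : ℂ) (hz : z.im ≠ 0) (f k : L2R) :
    inner ℂ (freeOp z hz f) k = inner ℂ f (freeOp (conj z) (im_conj_ne_zero hz) k) := by
  rw [inner_L2R_eq, inner_L2R_eq]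
  have hk : MemLp (fun x => conj (k x)) 2 volume := (Lp.memLp k).star
  have e1 : ∫ x, k x * conj ((freeOp z hz f) x) =
      conj (∫ x, conj (k x) * ∫ y, freeGreen z (x - y) * f y) := by
    rw [← integral_conj]
    refine integral_congr_ae ?_
    filter_upwards [coeFn_freeOp z hz f] with x hx
    rw [hx, map_mul, conj_conj]
  have e2 : ∫ x, (freeOp (conj z) (im_conj_ne_zero hz) k) x * conj (f x) =
      ∫ x, conj (f x) * ∫ y, freeGreen (conj z) (x - y) * k y := by
    refine integral_congr_ae ?_
    filter_upwards [coeFn_freeOp (conj z) (im_conj_ne_zero hz) k] with x hx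
    rw [hx, mul_comm]
  rw [e1, e2, integral_conv_swap (measurable_freeGreen z) (integrable_freeGreen hz) (Lp.memLp f)
    hk, ← integral_conj]
  refine integral_congr_ae (ae_of_all _ fun y => ?_)
  simp only [map_mul]
  congr 1
  rw [← integral_conj]
  refine integral_congr_ae (ae_of_all _ fun x => ?_)
  have := conj_freeGreen_conj (conj z) (x - y)
  rw [conj_conj] at this
  simp only [map_mul, conj_conj, this, neg_sub]

/-! ### Weak equations for the free resolvent and the Green function -/

theorem hasDerivAt_mul_exp {η : ℝ → ℂ} (hη : Differentiable ℝ η) (z : ℂ) (y x : ℝ) :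
    HasDerivAt (fun x : ℝ => η x * exp (-(I * z * (x - y : ℝ))))
      ((deriv η x - I * z * η x) * exp (-(I * z * (x - y : ℝ)))) x := by
  have h1 : HasDerivAt (fun x : ℝ => ((x - y : ℝ) : ℂ)) 1 x := by
    simpa using ((hasDerivAt_id x).sub_const y).ofReal_comp
  have h2 := ((h1.const_mul (I * z)).neg).cexp
  refine ((hη x).hasDerivAt.mul h2).congr_deriv ?_
  simp only [Pi.neg_apply]
  ring

/-- The free Green function is a fundamental solution of `i d/dx - z`, in weak form. -/
theorem integral_deriv_sub_mul_freeGreen {z : ℂ} (hz : z.im ≠ 0) {η : ℝ → ℂ}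
    (hη : ContDiff ℝ 1 η) (hc : HasCompactSupport η) (y : ℝ) :
    ∫ x, freeGreen z (x - y) * (deriv η x - I * z * η x) = I * η y := by
  -- On the half-line where the Green function lives, the integrand is a constant multiple of `F'`,
  -- so only the boundary value `F y = η y` survives.
  set F : ℝ → ℂ := fun x => η x * exp (-(I * z * (x - y : ℝ))) with hF
  have hd : deriv F = fun x => (deriv η x - I * z * η x) * exp (-(I * z * (x - y : ℝ))) :=
    funext fun x => (hasDerivAt_mul_exp (hη.differentiable (by norm_num)) z y x).deriv
  have hF1 : ContDiff ℝ 1 F := by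
    have : ContDiff ℝ 1 fun x : ℝ => ((x - y : ℝ) : ℂ) :=
      ofRealCLM.contDiff.comp (contDiff_id.sub contDiff_const)
    exact hη.mul (contDiff_const.mul this).neg.cexp
  have hFc : HasCompactSupport F := hc.mul_right
  have hFy : F y = η y := by simp [hF]
  rcases lt_or_gt_of_ne hz with h | h
  · have e : ∀ x, freeGreen z (x - y) * (deriv η x - I * z * η x) =
        Set.indicator (Set.Ioi y) (fun x => -I * deriv F x) x := by
      intro x
      rw [freeGreen_of_im_neg h, hd, Set.indicator_apply]
      simp only [Set.mem_Ioi, sub_pos]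
      split_ifs <;> ring
    simp only [e]
    rw [integral_indicator measurableSet_Ioi, integral_const_mul, hFc.integral_Ioi_deriv_eq hF1,
      hFy]
    ring
  · have e : ∀ x, freeGreen z (x - y) * (deriv η x - I * z * η x) =
        Set.indicator (Set.Iio y) (fun x => I * deriv F x) x := by
      intro x
      rw [freeGreen_of_im_pos h, hd, Set.indicator_apply]
      simp only [Set.mem_Iio, sub_neg]
      split_ifs <;> ring
    simp only [e]
    rw [integral_indicator measurableSet_Iio, ← integral_Iic_eq_integral_Iio, integral_const_mul,
      hFc.integral_Iic_deriv_eq hF1, hFy]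

theorem contDiff_ofReal_comp {η : ℝ → ℝ} (hη : ContDiff ℝ ∞ η) :
    ContDiff ℝ ∞ fun x => (η x : ℂ) :=
  ofRealCLM.contDiff.comp hη

theorem deriv_ofReal_comp' {η : ℝ → ℝ} (hη : Differentiable ℝ η) (x : ℝ) :
    deriv (fun x => (η x : ℂ)) x = deriv η x :=
  ((hη x).hasDerivAt.ofReal_comp).deriv

theorem hasCompactSupport_ofReal_comp {η : ℝ → ℝ} (hη : HasCompactSupport η) :
    HasCompactSupport fun x => (η x : ℂ) :=
  hη.comp_left (g := ((↑) : ℝ → ℂ)) ofReal_zero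

theorem integrable_mul_L2R {η : ℝ → ℂ} (hη : Continuous η) (hc : HasCompactSupport η)
    (ψ : L2R) : Integrable fun x => η x * ψ x :=
  (hη.memLp_of_hasCompactSupport (p := 2) hc).integrable_mul (Lp.memLp ψ)

/-- The weak differential equation in the form in which it is tested. -/
theorem hasWeakDerivOffZero_iff (z : ℂ) (ψ h : L2R) :
    HasWeakDerivOffZero ψ (-I • (h + z • ψ)) ↔
      ∀ η : ℝ → ℝ, ContDiff ℝ ∞ η → HasCompactSupport η → tsupport η ⊆ {0}ᶜ →
        ∫ x, (deriv (fun x => (η x : ℂ)) x - I * z * η x) * ψ x = I * ∫ x, η x * h x := by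
  refine forall_congr' fun η => forall_congr' fun h1 => forall_congr' fun h2 =>
    forall_congr' fun _ => ?_
  have hc1 := contDiff_ofReal_comp h1
  have hc2 := hasCompactSupport_ofReal_comp h2
  have e1 : ∫ x, deriv η x • ψ x = ∫ x, deriv (fun x => (η x : ℂ)) x * ψ x := by
    refine integral_congr_ae (ae_of_all _ fun x => ?_)
    simp only [deriv_ofReal_comp' (h1.differentiable (by simp)), real_smul]
  have e2 : ∫ x, η x • (-I • (h + z • ψ) : L2R) x =
      -I * ((∫ x, (η x : ℂ) * h x) + z * ∫ x, (η x : ℂ) * ψ x) := by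
    rw [← integral_const_mul z, ← integral_add (integrable_mul_L2R hc1.continuous hc2 h)
      ((integrable_mul_L2R hc1.continuous hc2 ψ).const_mul z), ← integral_const_mul]
    refine integral_congr_ae ?_
    filter_upwards [Lp.coeFn_smul (-I) (h + z • ψ), Lp.coeFn_add h (z • ψ),
      Lp.coeFn_smul z ψ] with x hx1 hx2 hx3
    rw [hx1, Pi.smul_apply, hx2, Pi.add_apply, hx3, Pi.smul_apply, real_smul]
    simp only [smul_eq_mul]
    ring
  have e3 : ∫ x, (deriv (fun x => (η x : ℂ)) x - I * z * η x) * ψ x =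
      (∫ x, deriv (fun x => (η x : ℂ)) x * ψ x) - I * z * ∫ x, (η x : ℂ) * ψ x := by
    rw [← integral_const_mul, ← integral_sub (integrable_mul_L2R
      (hc1.continuous_deriv (by simp)) hc2.deriv ψ)
      ((integrable_mul_L2R hc1.continuous hc2 ψ).const_mul _)]
    refine integral_congr_ae (ae_of_all _ fun x => ?_)
    simp only
    ring
  rw [e1, e2, e3]
  constructor
  · intro h; rw [h]; ring
  · intro h; rw [sub_eq_iff_eq_add] at h; rw [h]; ring

/-- Fubini moves the convolution onto the test function, where the fundamental-solution identity
applies for each `y`. -/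
theorem hasWeakDerivOffZero_freeOp (z : ℂ) (hz : z.im ≠ 0) (h : L2R) :
    HasWeakDerivOffZero (freeOp z hz h) (-I • (h + z • freeOp z hz h)) := by
  rw [hasWeakDerivOffZero_iff]
  intro η h1 h2 _
  have hc1 := contDiff_ofReal_comp h1
  have hc2 := hasCompactSupport_ofReal_comp h2
  have hk : MemLp (fun x => deriv (fun x => (η x : ℂ)) x - I * z * η x) 2 volume :=
    ((hc1.continuous_deriv (by simp)).memLp_of_hasCompactSupport hc2.deriv).sub
      ((hc1.continuous.memLp_of_hasCompactSupport hc2).const_mul _)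
  have e : ∫ x, (deriv (fun x => (η x : ℂ)) x - I * z * η x) * freeOp z hz h x =
      ∫ x, (deriv (fun x => (η x : ℂ)) x - I * z * η x) *
        ∫ y, freeGreen z (x - y) * h y := by
    refine integral_congr_ae ?_
    filter_upwards [coeFn_freeOp z hz h] with x hx
    rw [hx]
  rw [e, integral_conv_swap (measurable_freeGreen z) (integrable_freeGreen hz) (Lp.memLp h) hk,
    ← integral_const_mul]
  refine integral_congr_ae (ae_of_all _ fun y => ?_)
  simp only
  rw [integral_deriv_sub_mul_freeGreen hz (hc1.of_le (by simp)) hc2]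
  ring

/-- The fundamental-solution identity at `y = 0` leaves `i η(0)`, which vanishes because the support
of `η` avoids zero: the jump of `g_z` is invisible off zero. -/
theorem hasWeakDerivOffZero_freeGreenL (z : ℂ) (hz : z.im ≠ 0) :
    HasWeakDerivOffZero (freeGreenL z hz) (-I • (0 + z • freeGreenL z hz)) := by
  rw [hasWeakDerivOffZero_iff]
  intro η h1 h2 h3
  have hc1 := contDiff_ofReal_comp h1
  have hc2 := hasCompactSupport_ofReal_comp h2
  have h0 : η 0 = 0 := image_eq_zero_of_notMem_tsupport fun h => h3 h rfl
  have e : ∫ x, (η x : ℂ) * (0 : L2R) x = 0 := by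
    rw [← integral_zero ℝ ℂ]
    refine integral_congr_ae ?_
    filter_upwards [Lp.coeFn_zero ℂ 2 (volume : Measure ℝ)] with x hx
    rw [hx, Pi.zero_apply, mul_zero]
  have := integral_deriv_sub_mul_freeGreen hz (hc1.of_le (by simp)) hc2 0
  simp only [sub_zero, h0, ofReal_zero, mul_zero] at this
  rw [e, mul_zero, ← this]
  refine integral_congr_ae ?_
  filter_upwards [coeFn_freeGreenL z hz] with x hx
  rw [hx, mul_comm]

/-! ### Uniqueness of weak solutions on intervals -/

/-- A smooth compactly supported function of integral zero has a primitive of the same kind. -/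
theorem exists_primitive_of_integral_eq_zero {U : Set ℝ} (hU : U.OrdConnected) (hne : U.Nonempty)
    {ρ : ℝ → ℂ} (h1 : ContDiff ℝ ∞ ρ) (h2 : HasCompactSupport ρ) (h3 : tsupport ρ ⊆ U)
    (h0 : ∫ x, ρ x = 0) :
    ∃ F : ℝ → ℂ, ContDiff ℝ ∞ F ∧ HasCompactSupport F ∧ tsupport F ⊆ U ∧
      ∀ x, HasDerivAt F (ρ x) x := by
  obtain ⟨p, hp⟩ := hne
  -- Adding `p` keeps the compact set nonempty even when `ρ = 0`, so that its infimum and supremum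
  -- belong to it and hence to `U`.
  have hK : IsCompact (insert p (tsupport ρ)) := h2.isCompact.insert p
  have hKne : (insert p (tsupport ρ)).Nonempty := Set.insert_nonempty _ _
  have hKU : insert p (tsupport ρ) ⊆ U := Set.insert_subset hp h3
  set m := sInf (insert p (tsupport ρ)) with hm
  set M := sSup (insert p (tsupport ρ)) with hM
  have hmU : m ∈ U := hKU (hK.sInf_mem hKne)
  have hMU : M ∈ U := hKU (hK.sSup_mem hKne)
  have hlow : ∀ x, x < m → ρ x = 0 := fun x hx => image_eq_zero_of_notMem_tsupport fun h =>
    (csInf_le hK.bddBelow (Set.mem_insert_of_mem _ h)).not_gt hx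
  have hup : ∀ x, M < x → ρ x = 0 := fun x hx => image_eq_zero_of_notMem_tsupport fun h =>
    (le_csSup hK.bddAbove (Set.mem_insert_of_mem _ h)).not_gt hx
  have hmM : m ≤ M := (csInf_le hK.bddBelow (Set.mem_insert _ _)).trans
    (le_csSup hK.bddAbove (Set.mem_insert _ _))
  have hder : ∀ x, HasDerivAt (fun x => ∫ t in m..x, ρ t) (ρ x) x := fun x =>
    intervalIntegral.integral_hasDerivAt_right (h1.continuous.intervalIntegrable _ _)
      h1.continuous.stronglyMeasurable.stronglyMeasurableAtFilter h1.continuous.continuousAt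
  have hsupp : Function.support (fun x => ∫ t in m..x, ρ t) ⊆ Set.Icc m M := by
    intro x hx
    by_contra hnot
    refine hx ?_
    simp only
    rcases lt_or_ge x m with hxm | hxm
    · rw [intervalIntegral.integral_symm, intervalIntegral.integral_of_le hxm.le,
        ← integral_Icc_eq_integral_Ioc, integral_Icc_eq_integral_Ico,
        setIntegral_eq_zero_of_forall_eq_zero fun t ht => hlow t ht.2, neg_zero]
    · have hMx : M < x := by
        by_contra h
        exact hnot ⟨hxm, not_lt.1 h⟩
      rw [intervalIntegral.integral_of_le hxm, ← integral_Icc_eq_integral_Ioc,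
        setIntegral_eq_integral_of_forall_compl_eq_zero, h0]
      intro t ht
      rcases lt_or_ge t m with htm | htm
      · exact hlow t htm
      · refine hup t ?_
        by_contra h
        exact ht ⟨htm, (not_lt.1 h).trans hMx.le⟩
  have hts : tsupport (fun x => ∫ t in m..x, ρ t) ⊆ Set.Icc m M :=
    closure_minimal hsupp isClosed_Icc
  refine ⟨fun x => ∫ t in m..x, ρ t, ?_, ?_, hts.trans (hU.out hmU hMU), hder⟩
  · rw [contDiff_infty_iff_deriv]
    exact ⟨fun x => (hder x).differentiableAt, by rw [funext fun x => (hder x).deriv]; exact h1⟩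
  · exact isCompact_Icc.of_isClosed_subset (isClosed_tsupport _) hts

theorem tsupport_comp_zero_subset {η : ℝ → ℂ} {g : ℂ → ℝ} (hg : g 0 = 0) :
    tsupport (fun x => g (η x)) ⊆ tsupport η :=
  closure_mono fun x hx h => hx (by simp only [h, hg])

/-- The weak equation `D' = -i z D`, tested against complex-valued functions. -/
theorem integral_deriv_sub_mul_eq_zero {z : ℂ} {D : L2R}
    (hD : HasWeakDerivOffZero D (-I • (0 + z • D))) {η : ℝ → ℂ} (h1 : ContDiff ℝ ∞ η)
    (h2 : HasCompactSupport η) (h3 : tsupport η ⊆ {0}ᶜ) :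
    ∫ x, (deriv η x - I * z * η x) * D x = 0 := by
  rw [hasWeakDerivOffZero_iff] at hD
  have e0 : ∀ f : ℝ → ℝ, ∫ x, (f x : ℂ) * (0 : L2R) x = 0 := by
    intro f
    rw [← integral_zero ℝ ℂ]
    refine integral_congr_ae ?_
    filter_upwards [Lp.coeFn_zero ℂ 2 (volume : Measure ℝ)] with x hx
    rw [hx, Pi.zero_apply, mul_zero]
  have hre : ContDiff ℝ ∞ fun x => (η x).re := reCLM.contDiff.comp h1
  have him : ContDiff ℝ ∞ fun x => (η x).im := imCLM.contDiff.comp h1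
  have hrec : HasCompactSupport fun x => (η x).re := h2.comp_left (g := re) rfl
  have himc : HasCompactSupport fun x => (η x).im := h2.comp_left (g := im) rfl
  have er := hD _ hre hrec ((tsupport_comp_zero_subset (g := re) rfl).trans h3)
  have ei := hD _ him himc ((tsupport_comp_zero_subset (g := im) rfl).trans h3)
  rw [e0, mul_zero] at er ei
  have hint : ∀ f : ℝ → ℝ, ContDiff ℝ ∞ f → HasCompactSupport f →
      Integrable fun x => (deriv (fun x => (f x : ℂ)) x - I * z * f x) * D x := by
    intro f hf hfc
    have hc1 := contDiff_ofReal_comp hf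
    have hc2 := hasCompactSupport_ofReal_comp hfc
    exact integrable_mul_L2R ((hc1.continuous_deriv (by simp)).sub
      (continuous_const.mul hc1.continuous)) (hc2.deriv.sub hc2.mul_left) D
  have hsum : ∀ x, (deriv η x - I * z * η x) * D x =
      (deriv (fun x => ((η x).re : ℂ)) x - I * z * (η x).re) * D x +
        I * ((deriv (fun x => ((η x).im : ℂ)) x - I * z * (η x).im) * D x) := by
    intro x
    have d1 := ((contDiff_ofReal_comp hre).differentiable (by simp) x).hasDerivAt
    have d2 := ((contDiff_ofReal_comp him).differentiable (by simp) x).hasDerivAt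
    have d3 := (d1.add (d2.const_mul I)).deriv
    have e : (fun x => ((η x).re : ℂ)) + (fun x => I * ((η x).im : ℂ)) = η := by
      funext x
      simp only [Pi.add_apply]
      rw [mul_comm I, re_add_im]
    rw [e] at d3
    have e' : η x = (η x).re + (η x).im * I := (re_add_im (η x)).symm
    rw [d3]
    linear_combination -(I * z * D x) * e'
  simp only [hsum]
  rw [integral_add (hint _ hre hrec) ((hint _ him himc).const_mul I), integral_const_mul, er, ei]
  simp

/-- If `F' = e^{-izx} ζ`, then `η = e^{izx} F` satisfies `η' - izη = ζ`. Such an `F` with compact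
support in `U` exists because `ζ` integrates to zero against the exponential, so `η` is an
admissible test function. -/
theorem integral_mul_eq_zero_of_weak {z : ℂ} {D : L2R}
    (hD : HasWeakDerivOffZero D (-I • (0 + z • D))) {U : Set ℝ} (hU : U.OrdConnected)
    (hne : U.Nonempty) (hU0 : U ⊆ {0}ᶜ) {ζ : ℝ → ℂ} (h1 : ContDiff ℝ ∞ ζ)
    (h2 : HasCompactSupport ζ) (h3 : tsupport ζ ⊆ U)
    (h0 : ∫ x, exp (-(I * z * (x : ℝ))) * ζ x = 0) : ∫ x, ζ x * D x = 0 := by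
  have hx : ContDiff ℝ ∞ fun x : ℝ => (x : ℂ) := ofRealCLM.contDiff
  have hexp : ContDiff ℝ ∞ fun x : ℝ => exp (-(I * z * x)) := (contDiff_const.mul hx).neg.cexp
  obtain ⟨F, hF1, hF2, hF3, hF4⟩ := exists_primitive_of_integral_eq_zero hU hne (hexp.mul h1)
    h2.mul_left ((tsupport_mul_subset_right).trans h3) h0
  have hexp' : ContDiff ℝ ∞ fun x : ℝ => exp (I * z * x) := (contDiff_const.mul hx).cexp
  have key := integral_deriv_sub_mul_eq_zero hD (hexp'.mul hF1) hF2.mul_left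
    ((tsupport_mul_subset_right).trans (hF3.trans hU0))
  rw [← key]
  refine integral_congr_ae (ae_of_all _ fun x => ?_)
  simp only
  congr 1
  have hdx : HasDerivAt (fun x : ℝ => I * z * (x : ℂ)) (I * z * 1) x :=
    ((hasDerivAt_id x).ofReal_comp).const_mul (I * z)
  have hd := (hdx.cexp.mul (hF4 x)).deriv
  have hee : exp (I * z * x) * exp (-(I * z * x)) = 1 := by
    rw [← Complex.exp_add]; simp
  refine Eq.symm ?_
  calc _ = exp (I * z * x) * (I * z * 1) * F x +
        exp (I * z * x) * (exp (-(I * z * x)) * ζ x) - I * z * (exp (I * z * x) * F x) := by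
          rw [← hd]; rfl
    _ = (exp (I * z * x) * exp (-(I * z * x))) * ζ x := by ring
    _ = ζ x := by rw [hee, one_mul]

/-- A weak solution of `D' = -i z D` on an interval is a multiple of the exponential. -/
theorem exists_ae_eq_const_mul_exp {z : ℂ} {D : L2R}
    (hD : HasWeakDerivOffZero D (-I • (0 + z • D))) {U : Set ℝ} (hUo : IsOpen U)
    (hU : U.OrdConnected) (hne : U.Nonempty) (hU0 : U ⊆ {0}ᶜ) :
    ∃ C : ℂ, ∀ᵐ x : ℝ, x ∈ U → D x = C * exp (-(I * z * x)) := by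
  obtain ⟨p, hp⟩ := hne
  obtain ⟨f, hf1, hf2, hf3, hfr, hfp⟩ :=
    exists_contDiff_tsupport_subset (n := ⊤) (hUo.mem_nhds hp)
  have hx : ContDiff ℝ ∞ fun x : ℝ => (x : ℂ) := ofRealCLM.contDiff
  have hexp : ContDiff ℝ ∞ fun x : ℝ => exp (-(I * z * x)) := (contDiff_const.mul hx).neg.cexp
  have hexp' : ContDiff ℝ ∞ fun x : ℝ => exp (I * z * x) := (contDiff_const.mul hx).cexp
  have hee : ∀ x : ℝ, exp (-(I * z * x)) * exp (I * z * x) = 1 := fun x => by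
    rw [← Complex.exp_add]; simp
  -- Du Bois-Reymond argument: `ζ₀` has integral `N ≠ 0` against `e^{-izx}`, so a suitable multiple
  -- of it can be subtracted from any test function to make that integral zero.
  set ζ₀ : ℝ → ℂ := fun x => exp (I * z * x) * f x with hζ₀
  have hf : ContDiff ℝ ∞ fun x => (f x : ℂ) := contDiff_ofReal_comp hf3
  have hfc : HasCompactSupport fun x => (f x : ℂ) := hasCompactSupport_ofReal_comp hf2
  have hs₀ : ContDiff ℝ ∞ ζ₀ := hexp'.mul hf
  have hc₀ : HasCompactSupport ζ₀ := hfc.mul_left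
  have tsupport_coe : ∀ g : ℝ → ℝ, tsupport (fun x => (g x : ℂ)) ⊆ tsupport g := fun g =>
    closure_mono fun x hx h => hx (by simp only [h, ofReal_zero])
  have ht₀ : tsupport ζ₀ ⊆ U := tsupport_mul_subset_right.trans ((tsupport_coe f).trans hf1)
  have hpos : 0 < ∫ x, f x := by
    refine hf3.continuous.integral_pos_of_hasCompactSupport_nonneg_nonzero hf2
      (fun x => (hfr ⟨x, rfl⟩).1) (x := p) ?_
    rw [hfp]; exact one_ne_zero
  have hN : (∫ x, (f x : ℂ)) ≠ 0 := by
    rw [integral_complex_ofReal]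
    exact_mod_cast hpos.ne'
  set N := ∫ x, (f x : ℂ) with hNdef
  refine ⟨(∫ x, ζ₀ x * D x) / N, ?_⟩
  have hloc : LocallyIntegrableOn (fun x : ℝ => D x - (∫ x, ζ₀ x * D x) / N *
      exp (-(I * z * x))) U :=
    (((Lp.memLp D).locallyIntegrable (by norm_num)).sub
      (continuous_const.mul hexp.continuous).locallyIntegrable).locallyIntegrableOn _
  have := hUo.ae_eq_zero_of_integral_contDiff_smul_eq_zero hloc ?_
  · filter_upwards [this] with x hx hxU
    exact sub_eq_zero.1 (hx hxU)
  intro g hg1 hg2 hg3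
  have hg : ContDiff ℝ ∞ fun x => (g x : ℂ) := contDiff_ofReal_comp hg1
  have hgc : HasCompactSupport fun x => (g x : ℂ) := hasCompactSupport_ofReal_comp hg2
  set c := (∫ x : ℝ, exp (-(I * z * x)) * g x) / N with hc
  have hint1 : Integrable fun x : ℝ => exp (-(I * z * x)) * (g x : ℂ) :=
    (hexp.mul hg).continuous.integrable_of_hasCompactSupport hgc.mul_left
  have hint2 : Integrable fun x : ℝ => (f x : ℂ) :=
    hf.continuous.integrable_of_hasCompactSupport hfc
  have key := integral_mul_eq_zero_of_weak hD hU ⟨p, hp⟩ hU0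
    (ζ := fun x => (g x : ℂ) - c * ζ₀ x) (hg.sub (contDiff_const.mul hs₀))
    (hgc.sub hc₀.mul_left) ?_ ?_
  · have e1 : ∫ x, ((g x : ℂ) - c * ζ₀ x) * D x =
        (∫ x, (g x : ℂ) * D x) - c * ∫ x, ζ₀ x * D x := by
      rw [← integral_const_mul, ← integral_sub (integrable_mul_L2R hg.continuous hgc D)
        ((integrable_mul_L2R hs₀.continuous hc₀ D).const_mul _)]
      refine integral_congr_ae (ae_of_all _ fun x => ?_)
      simp only
      ring
    have e2 : ∫ x, g x • (D x - (∫ x, ζ₀ x * D x) / N * exp (-(I * z * x))) =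
        (∫ x, (g x : ℂ) * D x) -
          (∫ x, ζ₀ x * D x) / N * ∫ x : ℝ, exp (-(I * z * x)) * g x := by
      rw [← integral_const_mul, ← integral_sub (integrable_mul_L2R hg.continuous hgc D)
        (hint1.const_mul _)]
      refine integral_congr_ae (ae_of_all _ fun x => ?_)
      simp only [real_smul]
      ring
    rw [e2, ← key, e1, hc]
    ring
  · refine (tsupport_sub _ _).trans (Set.union_subset ((tsupport_coe g).trans hg3) ?_)
    exact tsupport_mul_subset_right.trans ht₀
  · have e3 : ∀ x : ℝ, exp (-(I * z * x)) * ((g x : ℂ) - c * ζ₀ x) =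
        exp (-(I * z * x)) * g x - c * f x := by
      intro x
      rw [hζ₀]
      linear_combination (-c * f x) * hee x
    simp only [e3]
    rw [integral_sub hint1 (hint2.const_mul c), integral_const_mul, ← hNdef, hc]
    field_simp
    ring

/-- Off zero, the homogeneous equation has no square-integrable solution without a jump. -/
theorem eq_zero_of_weak_of_values {z : ℂ} (hz : z.im ≠ 0) {D : L2R} {d : ℂ}
    (hD : HasWeakDerivOffZero D (-I • (0 + z • D))) (hl : HasLeftValue D d)
    (hr : HasRightValue D d) : D = 0 := by
  obtain ⟨C₁, h₁⟩ := exists_ae_eq_const_mul_exp hD isOpen_Iio Set.ordConnected_Iio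
    ⟨-1, by norm_num⟩ (fun x (hx : x < 0) => ne_of_lt hx)
  obtain ⟨C₂, h₂⟩ := exists_ae_eq_const_mul_exp hD isOpen_Ioi Set.ordConnected_Ioi
    ⟨1, by norm_num⟩ (fun x (hx : 0 < x) => ne_of_gt hx)
  have := neBot_left
  have := neBot_right
  have e₁ : C₁ = d := by
    refine tendsto_nhds_unique ?_ hl
    refine ((tendsto_exp_nhds_zero z (𝓝[<] 0) nhdsWithin_le_nhds C₁).mono_left
      inf_le_left).congr' ?_
    filter_upwards [h₁.filter_mono inf_le_right, Filter.Eventually.filter_mono inf_le_left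
      (self_mem_nhdsWithin (a := (0 : ℝ)) (s := Set.Iio 0))] with x hx hx0
    exact (hx hx0).symm
  have e₂ : C₂ = d := by
    refine tendsto_nhds_unique ?_ hr
    refine ((tendsto_exp_nhds_zero z (𝓝[>] 0) nhdsWithin_le_nhds C₂).mono_left
      inf_le_left).congr' ?_
    filter_upwards [h₂.filter_mono inf_le_right, Filter.Eventually.filter_mono inf_le_left
      (self_mem_nhdsWithin (a := (0 : ℝ)) (s := Set.Ioi 0))] with x hx hx0
    exact (hx hx0).symm
  subst e₁
  have hn : ∀ x : ℝ, ‖exp (-(I * z * x))‖ = Real.exp (z.im * x) := by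
    intro x
    rw [norm_exp]
    simp
  -- On the half-line where `z.im * x ≥ 0` the exponential has modulus at least one, so `D` in `L2`
  -- makes a constant square integrable on a set of infinite measure. Since the constants on the two
  -- sides agree, one half-line suffices.
  have key : ∀ S : Set ℝ, MeasurableSet S → volume S = ⊤ → (∀ x ∈ S, 0 ≤ z.im * x) →
      (∀ᵐ x : ℝ, x ∈ S → D x = C₁ * exp (-(I * z * x))) → C₁ = 0 := by
    intro S hS hvol hpos hae
    have hm : MemLp (fun _ : ℝ => C₁) 2 (volume.restrict S) := by
      refine ((Lp.memLp D).restrict S).of_le aestronglyMeasurable_const ?_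
      filter_upwards [(ae_restrict_iff' hS).2 hae, ae_restrict_mem hS] with x hx hxS
      rw [hx, norm_mul, hn]
      exact le_mul_of_one_le_right (norm_nonneg _) (Real.one_le_exp (hpos x hxS))
    rcases (memLp_const_iff (by norm_num) (by norm_num)).1 hm with h | h
    · exact h
    · simp [hvol] at h
  have hC : C₁ = 0 := by
    rcases lt_or_gt_of_ne hz with h | h
    · exact key (Set.Iio 0) measurableSet_Iio Real.volume_Iio
        (fun x hx => (mul_pos_of_neg_of_neg h hx).le) h₁
    · refine key (Set.Ioi 0) measurableSet_Ioi Real.volume_Ioi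
        (fun x hx => (mul_pos h hx).le) (e₂ ▸ h₂)
  refine (Lp.eq_zero_iff_ae_eq_zero).2 ?_
  filter_upwards [h₁, h₂, compl_mem_ae_iff.2 (measure_singleton (0 : ℝ))] with x hx1 hx2 hx0
  rcases lt_or_gt_of_ne (show x ≠ 0 from hx0) with h | h
  · rw [hx1 h, hC]; simp
  · rw [hx2 h, e₂, hC]; simp

/-! ### Representation of functions by the free Green function -/

theorem heaviside_im_add (z : ℂ) (hz : z.im ≠ 0) :
    heaviside z.im + heaviside (-z.im) = 1 := by
  rcases lt_or_gt_of_ne hz with h | h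
  · simp [heaviside, h, h.not_gt]
  · simp [heaviside, h, h.not_gt]

theorem HasLeftValue.eq {ψ : L2R} {a b : ℂ} (h : HasLeftValue ψ a) (h' : HasLeftValue ψ b) :
    a = b := by
  have := neBot_left
  exact tendsto_nhds_unique h h'

theorem HasRightValue.eq {ψ : L2R} {a b : ℂ} (h : HasRightValue ψ a) (h' : HasRightValue ψ b) :
    a = b := by
  have := neBot_right
  exact tendsto_nhds_unique h h'

theorem hasLeftValue_freeOp_add (z : ℂ) (hz : z.im ≠ 0) (k : L2R) (c : ℂ) :
    HasLeftValue (freeOp z hz k + c • freeGreenL z hz)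
      (inner ℂ (freeGreenL (conj z) (im_conj_ne_zero hz)) k + c * (I * heaviside z.im)) :=
  tendsto_L2R_add (tendsto_freeOp z hz k nhdsWithin_le_nhds)
    (tendsto_L2R_smul c (hasLeftValue_freeGreenL z hz))

theorem hasRightValue_freeOp_add (z : ℂ) (hz : z.im ≠ 0) (k : L2R) (c : ℂ) :
    HasRightValue (freeOp z hz k + c • freeGreenL z hz)
      (inner ℂ (freeGreenL (conj z) (im_conj_ne_zero hz)) k + c * (-I * heaviside (-z.im))) :=
  tendsto_L2R_add (tendsto_freeOp z hz k nhdsWithin_le_nhds)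
    (tendsto_L2R_smul c (hasRightValue_freeGreenL z hz))

theorem hasWeakDerivOffZero_freeOp_add (z : ℂ) (hz : z.im ≠ 0) (k : L2R) (c : ℂ) :
    HasWeakDerivOffZero (freeOp z hz k + c • freeGreenL z hz)
      (-I • (k + z • (freeOp z hz k + c • freeGreenL z hz))) := by
  convert (hasWeakDerivOffZero_freeOp z hz k).add
    ((hasWeakDerivOffZero_freeGreenL z hz).smul c) using 1
  module

/-- A function on the punctured line with a weak derivative and one-sided values is recovered
from `i φ - z ψ` and its jump. -/
theorem eq_freeOp_add (z : ℂ) (hz : z.im ≠ 0) {ψ φ : L2R} {a b : ℂ}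
    (hφ : HasWeakDerivOffZero ψ φ) (ha : HasLeftValue ψ a) (hb : HasRightValue ψ b) :
    ψ = freeOp z hz (I • φ - z • ψ) + (I * (b - a)) • freeGreenL z hz := by
  set k := I • φ - z • ψ with hk
  -- The jump of `g_z` at zero, right minus left, is `-i`; this coefficient reproduces the jump `b -
  -- a`.
  set c := I * (b - a) with hc
  set m := inner ℂ (freeGreenL (conj z) (im_conj_ne_zero hz)) k
  have hl := tendsto_L2R_add ha
    (tendsto_L2R_smul (-1) (hasLeftValue_freeOp_add z hz k c))
  have hr := tendsto_L2R_add hb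
    (tendsto_L2R_smul (-1) (hasRightValue_freeOp_add z hz k c))
  have hw := hφ.add ((hasWeakDerivOffZero_freeOp_add z hz k c).smul (-1))
  have hab : a + -1 * (m + c * (I * heaviside z.im)) =
      b + -1 * (m + c * (-I * heaviside (-z.im))) := by
    have := heaviside_im_add z hz
    rw [hc]
    linear_combination (b - a) * this +
      (b - a) * (-heaviside z.im - heaviside (-z.im)) * I_sq
  have h0 := eq_zero_of_weak_of_values hz (z := z)
    (D := ψ + (-1 : ℂ) • (freeOp z hz k + c • freeGreenL z hz)) (d := a + -1 * (m + c * (I * heaviside z.im))) ?_ hl (hab ▸ hr)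
  · rw [neg_one_smul, ← sub_eq_add_neg, sub_eq_zero] at h0
    exact h0
  · convert hw using 1
    have hφ' : φ = -I • k + -I • z • ψ := by
      rw [hk, smul_sub, smul_smul, neg_mul, I_mul_I, neg_neg, one_smul]
      abel
    nth_rewrite 1 [hφ']
    module

/-! ### Boundary form and symmetry -/

theorem conj_inner_L2R (f g : L2R) : conj (inner ℂ f g : ℂ) = inner ℂ g f :=
  inner_conj_symm g f

/-- Integration by parts on the punctured line. -/
theorem inner_weakDeriv_sub {ψ φ ψ' φ' : L2R} {a b a' b' : ℂ}
    (hφ : HasWeakDerivOffZero ψ φ) (ha : HasLeftValue ψ a) (hb : HasRightValue ψ b)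
    (hφ' : HasWeakDerivOffZero ψ' φ') (ha' : HasLeftValue ψ' a') (hb' : HasRightValue ψ' b') :
    inner ℂ ψ' (I • φ) - inner ℂ (I • φ') ψ = I * (a * conj a' - b * conj b') := by
  -- `ψ` is represented at `i` and `ψ'` at `-i`, so that the two free resolvents are adjoint and
  -- cancel. Moreover `g_i` vanishes on the right and `g_{-i}` on the left, so `b` and `a'` are bare
  -- pairings with no jump term.
  have hI : (conj (-I)).im ≠ 0 := by simp
  have hJ : (-I).im ≠ 0 := by simp
  have hcc : conj (conj (-I)) = -I := conj_conj _
  have r := eq_freeOp_add (conj (-I)) hI hφ ha hb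
  have r' := eq_freeOp_add (-I) hJ hφ' ha' hb'
  set f := I • φ - conj (-I) • ψ with hf
  set f' := I • φ' - (-I) • ψ' with hf'
  have vb : b = inner ℂ (freeGreenL (-I) hJ) f := by
    have h1 := hasRightValue_freeOp_add (conj (-I)) hI f (I * (b - a))
    rw [← r] at h1
    have h2 := hb.eq h1
    simp only [hcc] at h2
    rw [h2]
    simp [heaviside]
  have va : a' = inner ℂ (freeGreenL (conj (-I)) hI) f' := by
    have h1 := hasLeftValue_freeOp_add (-I) hJ f' (I * (b' - a'))
    rw [← r'] at h1
    rw [ha'.eq h1]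
    simp [heaviside]
  have e1 : inner ℂ ψ' (I • φ) = inner ℂ ψ' f + conj (-I) * inner ℂ ψ' ψ := by
    rw [hf, inner_sub_right, inner_smul_right _ _ (conj (-I))]; ring
  have e2 : inner ℂ (I • φ') ψ = inner ℂ f' ψ + conj (-I) * inner ℂ ψ' ψ := by
    rw [hf', inner_sub_left, inner_smul_left _ _ (-I)]; ring
  have e3 : inner ℂ ψ' f = inner ℂ (freeOp (-I) hJ f') f + conj (I * (b' - a')) * b := by
    nth_rewrite 1 [r']
    rw [inner_add_left, inner_smul_left, ← vb]
  have e4 : inner ℂ f' ψ = inner ℂ f' (freeOp (conj (-I)) hI f) + I * (b - a) * conj a' := by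
    nth_rewrite 1 [r]
    rw [inner_add_right, inner_smul_right, va, conj_inner_L2R]
  rw [e1, e2, e3, e4, inner_freeOp_left]
  simp only [map_mul, map_sub, conj_I]
  ring

/-- The operator `A(v, α)` is symmetric. -/
theorem MomentumRel.inner_eq {v : L2R} {α : ℝ} {ψ χ ψ' χ' : L2R} (h : MomentumRel v α ψ χ)
    (h' : MomentumRel v α ψ' χ') : inner ℂ χ' ψ = inner ℂ ψ' χ := by
  obtain ⟨φ, a, b, h1, h2, h3, h4, h5⟩ := h
  obtain ⟨φ', a', b', h1', h2', h3', h4', h5'⟩ := h'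
  -- With `B = e^{-iα} b`, the boundary form `a ā' - B B̄'` equals half of `(a - B)(ā' + B̄') + (a +
  -- B)(ā' - B̄')`. The boundary conditions turn the two `v` terms into exactly these products.
  have hlag := inner_weakDeriv_sub h1 h2 h3 h1' h2' h3'
  have hc := congrArg conj h4'
  rw [conj_inner_L2R] at hc
  have hee : conj (exp (-(I * α))) = exp (I * α) := by
    rw [← exp_conj]; simp
  have hinv : exp (-(I * α)) * exp (I * α) = 1 := by
    rw [← Complex.exp_add]; simp
  have hle : ((starRingEnd ℂ) ((a' + exp (-(I * α)) * b') / 2)) =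
      (conj a' + exp (I * α) * conj b') / 2 := by
    simp only [map_div₀, map_add, map_mul, hee, map_ofNat]
  simp only [map_sub, map_mul, conj_I, hee] at hc
  rw [h5, h5', inner_add_left, inner_add_right, inner_smul_left v,
    inner_smul_right _ v, hle,
    ← h4, ← hc]
  linear_combination -hlag - I * b * conj b' * hinv

theorem momentumOp_symm (v : L2R) (α : ℝ) (x y : (momentumOp v α).domain) :
    inner ℂ (momentumOp v α x) (y : L2R) = inner ℂ (x : L2R) (momentumOp v α y) :=
  ((mem_momentumOp_graph v α _ _).1 ((momentumOp v α).mem_graph y)).inner_eq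
    ((mem_momentumOp_graph v α _ _).1 ((momentumOp v α).mem_graph x))

/-! ### Symmetric operators with surjective shifts -/

section Abstract

variable {E : Type*} [NormedAddCommGroup E] [InnerProductSpace ℂ E]

theorem LinearPMap.inner_sub_smul_of_symm {A : E →ₗ.[ℂ] E}
    (hs : ∀ x y : A.domain, inner ℂ (A x) (y : E) = inner ℂ (x : E) (A y)) (z : ℂ)
    (x y : A.domain) :
    inner ℂ (A x - conj z • (x : E)) (y : E) = inner ℂ (x : E) (A y - z • (y : E)) := by
  rw [inner_sub_left, inner_sub_right, hs, inner_smul_left, inner_smul_right, conj_conj]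

theorem LinearPMap.eq_zero_of_symm {A : E →ₗ.[ℂ] E}
    (hs : ∀ x y : A.domain, inner ℂ (A x) (y : E) = inner ℂ (x : E) (A y)) {z : ℂ}
    (hz : z.im ≠ 0) (x : A.domain) (hx : A x = z • (x : E)) : (x : E) = 0 := by
  have h := hs x x
  rw [hx, inner_smul_left, inner_smul_right, ← sub_eq_zero, ← sub_mul, mul_eq_zero] at h
  rcases h with h | h
  · exfalso
    have := congrArg Complex.im h
    simp only [sub_im, conj_im, zero_im] at this
    exact hz (by linarith)
  · exact inner_self_eq_zero.1 h

variable [CompleteSpace E]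

/-- For `u` orthogonal to the domain, write `u = (A - z)x` and `x = (A - conj z)y`; symmetry gives
`⟪x, x⟫ = ⟪y, u⟫ = 0`, hence `u = 0`. -/
theorem LinearPMap.dense_domain_of_symm_of_surjective {A : E →ₗ.[ℂ] E}
    (hs : ∀ x y : A.domain, inner ℂ (A x) (y : E) = inner ℂ (x : E) (A y)) {z : ℂ}
    (h₁ : ∀ h, ∃ x : A.domain, A x - z • (x : E) = h)
    (h₂ : ∀ h, ∃ x : A.domain, A x - conj z • (x : E) = h) :
    Dense (A.domain : Set E) := by
  rw [Submodule.dense_iff_topologicalClosure_eq_top,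
    Submodule.topologicalClosure_eq_top_iff, Submodule.eq_bot_iff]
  intro u hu
  obtain ⟨x, hx⟩ := h₁ u
  obtain ⟨y, hy⟩ := h₂ x
  have h := LinearPMap.inner_sub_smul_of_symm hs z y x
  rw [hx, hy, (Submodule.mem_orthogonal _ _).1 hu y y.2, inner_self_eq_zero] at h
  have hx0 : x = 0 := Subtype.ext h
  rw [← hx, hx0]
  simp

/-- For `y` in the domain of the adjoint, solve `(A - z)x = (A* - z)y`. Then `y - x` is orthogonal
to the range of `A - conj z`, which is everything, so `y = x` lies in the domain of `A`. -/
theorem LinearPMap.isSelfAdjoint_of_symm_of_surjective {A : E →ₗ.[ℂ] E}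
    (hs : ∀ x y : A.domain, inner ℂ (A x) (y : E) = inner ℂ (x : E) (A y)) {z : ℂ}
    (h₁ : ∀ h, ∃ x : A.domain, A x - z • (x : E) = h)
    (h₂ : ∀ h, ∃ x : A.domain, A x - conj z • (x : E) = h) :
    IsSelfAdjoint A := by
  have hd := LinearPMap.dense_domain_of_symm_of_surjective hs h₁ h₂
  rw [LinearPMap.isSelfAdjoint_def]
  have hle : A ≤ A.adjoint := LinearPMap.IsFormalAdjoint.le_adjoint hd hs
  refine (LinearPMap.eq_of_le_of_domain_eq hle (le_antisymm hle.1 ?_)).symm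
  intro y hy
  have hadj : ∀ t : A.domain, inner ℂ (A.adjoint ⟨y, hy⟩) (t : E) = inner ℂ y (A t) :=
    fun t => LinearPMap.adjoint_isFormalAdjoint hd ⟨y, hy⟩ t
  obtain ⟨x, hx⟩ := h₁ (A.adjoint ⟨y, hy⟩ - z • y)
  obtain ⟨t, ht⟩ := h₂ (y - x)
  have hxt : inner ℂ (A x - z • (x : E)) (t : E) =
      inner ℂ (x : E) (A t - conj z • (t : E)) := by
    have := LinearPMap.inner_sub_smul_of_symm hs (conj z) x t
    rwa [conj_conj] at this
  have hyt : inner ℂ (A.adjoint ⟨y, hy⟩ - z • y) (t : E) =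
      inner ℂ y (A t - conj z • (t : E)) := by
    rw [inner_sub_left, inner_sub_right, hadj, inner_smul_left, inner_smul_right]
  have h0 : inner ℂ (y - x) (y - x) = (0 : ℂ) := by
    nth_rewrite 2 [← ht]
    rw [inner_sub_left, ← hxt, ← hyt, hx, sub_self]
  rw [sub_eq_zero.1 (inner_self_eq_zero.1 h0)]
  exact x.2

end Abstract

/-! ### Pairings with the free Green function -/

theorem conj_pairing (f g : ℝ → ℂ) : conj (pairing f g) = pairing g f := by
  rw [pairing, pairing, ← integral_conj]
  refine integral_congr_ae (ae_of_all _ fun x => ?_)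
  simp only [map_mul, conj_conj]
  ring

theorem pairing_eq_inner {f g : ℝ → ℂ} {F G : L2R} (hf : F =ᵐ[volume] f) (hg : G =ᵐ[volume] g) :
    pairing f g = inner ℂ G F := by
  rw [inner_L2R_eq, pairing]
  refine integral_congr_ae ?_
  filter_upwards [hf, hg] with x h1 h2
  rw [h1, h2]

/-- The functions `e₁, e₂` as elements of `L2`. -/
def freeEL (v : L2R) (z : ℂ) (hz : z.im ≠ 0) : Fin 2 → L2R :=
  ![freeGreenL z hz, freeOp z hz v]

theorem coeFn_freeEL (v : L2R) (z : ℂ) (hz : z.im ≠ 0) (j : Fin 2) :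
    freeEL v z hz j =ᵐ[volume] freeE v z j := by
  fin_cases j
  · exact coeFn_freeGreenL z hz
  · exact coeFn_freeOp z hz v

theorem memLp_freeE (v : L2R) (z : ℂ) (hz : z.im ≠ 0) (j : Fin 2) :
    MemLp (freeE v z j) 2 volume :=
  (memLp_congr_ae (coeFn_freeEL v z hz j)).1 (Lp.memLp _)

/-- `⟨g_z, v⟩`. -/
def greenPairing (v : L2R) (z : ℂ) : ℂ := pairing (freeGreen z) v

/-- `⟨v, g_{conj z}⟩`. -/
def pairingGreen (v : L2R) (z : ℂ) : ℂ := pairing v (freeGreen (conj z))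

/-- `⟨e₂(·, z), v⟩`. -/
def greenForm (v : L2R) (z : ℂ) : ℂ := pairing (freeE v z 1) v

theorem conj_greenPairing_conj (v : L2R) (z : ℂ) :
    conj (greenPairing v (conj z)) = pairingGreen v z :=
  conj_pairing _ _

theorem conj_pairingGreen_conj (v : L2R) (z : ℂ) :
    conj (pairingGreen v (conj z)) = greenPairing v z := by
  rw [pairingGreen, conj_conj, conj_pairing, greenPairing]

theorem greenPairing_eq_inner (v : L2R) (z : ℂ) (hz : z.im ≠ 0) :
    greenPairing v z = inner ℂ v (freeGreenL z hz) :=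
  pairing_eq_inner (coeFn_freeGreenL z hz) EventuallyEq.rfl

theorem pairingGreen_eq_inner (v : L2R) (z : ℂ) (hz : z.im ≠ 0) :
    pairingGreen v z = inner ℂ (freeGreenL (conj z) (im_conj_ne_zero hz)) v :=
  pairing_eq_inner EventuallyEq.rfl (coeFn_freeGreenL _ _)

theorem greenForm_eq_inner (v : L2R) (z : ℂ) (hz : z.im ≠ 0) :
    greenForm v z = inner ℂ v (freeOp z hz v) :=
  pairing_eq_inner (coeFn_freeOp z hz v) EventuallyEq.rfl

theorem conj_greenForm_conj (v : L2R) (z : ℂ) (hz : z.im ≠ 0) :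
    conj (greenForm v (conj z)) = greenForm v z := by
  rw [greenForm_eq_inner v _ (im_conj_ne_zero hz), greenForm_eq_inner v z hz,
    ← inner_freeOp_left, conj_inner_L2R]

/-! ### The functions `E₁`, `E₂` of the point interaction -/

/-- The factor `κ` with `E₁(·, z) = κ(z) g_z` off zero. -/
def leftFactor (α : ℝ) (z : ℂ) : ℂ := heaviside z.im + exp (I * α) * heaviside (-z.im)

theorem heaviside_of_pos {t : ℝ} (h : 0 < t) : heaviside t = 1 := if_pos h

theorem heaviside_of_neg {t : ℝ} (h : t < 0) : heaviside t = 0 := if_neg h.not_gt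

theorem conj_exp_I_mul (α : ℝ) : conj (exp (I * α)) = exp (-(I * α)) := by
  rw [← exp_conj]; simp

theorem conj_exp_neg_I_mul (α : ℝ) : conj (exp (-(I * α))) = exp (I * α) := by
  rw [← exp_conj]; simp

theorem exp_neg_mul_exp (α : ℝ) : exp (-(I * α)) * exp (I * α) = 1 := by
  rw [← Complex.exp_add]; simp

theorem conj_betaCoeff_conj (α : ℝ) (z : ℂ) : conj (betaCoeff α (conj z)) = betaCoeff α z := by
  simp only [betaCoeff, map_add, map_mul, map_sub, map_one, conj_I, conj_heaviside, conj_im,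
    conj_exp_I_mul, conj_exp_neg_I_mul, neg_neg]
  ring

theorem conj_leftFactor_conj (α : ℝ) (z : ℂ) :
    conj (leftFactor α (conj z)) = heaviside (-z.im) + exp (-(I * α)) * heaviside z.im := by
  simp only [leftFactor, map_add, map_mul, conj_heaviside, conj_im, conj_exp_I_mul, neg_neg]

theorem one_sub_betaCoeff_mul (α : ℝ) (z : ℂ) (hz : z.im ≠ 0) :
    1 + betaCoeff α z * (-I * heaviside (-z.im)) = leftFactor α z := by
  rcases lt_or_gt_of_ne hz with h | h
  · simp only [betaCoeff, leftFactor, heaviside_of_neg h, heaviside_of_pos (neg_pos.2 h)]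
    linear_combination (1 - exp (I * α)) * I_sq
  · simp only [betaCoeff, leftFactor, heaviside_of_pos h, heaviside_of_neg (neg_neg_iff_pos.2 h)]
    ring

/-- Since `conj g_{conj z}(y) = g_z(-y)`, the limit `y → -0` reads `g_z` from the right. The point
`x = 0` is excluded because the term `g_z(x - y)` is continuous in `y` at zero only for `x ≠ 0`. -/
theorem pointE_zero_apply (v : L2R) (α : ℝ) {z : ℂ} (hz : z.im ≠ 0) {x : ℝ} (hx : x ≠ 0) :
    pointE v α z 0 x = leftFactor α z * freeGreen z x := by
  have h1 : Tendsto (fun y => freeGreen z (x - y)) (𝓝[<] 0) (𝓝 (freeGreen z x)) := by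
    have hc : ContinuousAt (fun y => freeGreen z (x - y)) 0 := by
      refine ContinuousAt.comp (g := freeGreen z) (f := fun y : ℝ => x - y) ?_ (by fun_prop)
      rw [sub_zero]
      exact continuousAt_freeGreen z hx
    have := hc.tendsto
    rw [sub_zero] at this
    exact this.mono_left nhdsWithin_le_nhds
  have hneg : Tendsto (fun y : ℝ => -y) (𝓝[<] 0) (𝓝[>] 0) := by
    have := tendsto_neg_nhdsLT (a := (0 : ℝ))
    rwa [neg_zero] at this
  have h2 := (tendsto_freeGreen_right hz).comp hneg
  have h3 : Tendsto (fun y => pointGreen α z x y) (𝓝[<] 0)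
      (𝓝 (freeGreen z x + freeGreen z x * betaCoeff α z * (-I * heaviside (-z.im)))) := by
    refine h1.add ((h2.const_mul (freeGreen z x * betaCoeff α z)).congr fun y => ?_)
    rw [conj_freeGreen_conj]
    rfl
  have h4 := leftLim_eq_of_tendsto h3
  change Function.leftLim (fun y => pointGreen α z x y) 0 = _
  rw [h4, ← one_sub_betaCoeff_mul α z hz]
  ring

theorem integrable_conj_mul {f : ℝ → ℂ} (hf : MemLp f 2 volume) (h : L2R) :
    Integrable fun y => conj (f y) * h y :=
  MemLp.integrable_mul (p := 2) (q := 2) hf.star (Lp.memLp h)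

theorem pointE_one_apply (v : L2R) (α : ℝ) {z : ℂ} (hz : z.im ≠ 0) (x : ℝ) :
    pointE v α z 1 x = freeE v z 1 x + betaCoeff α z * pairingGreen v z * freeGreen z x := by
  change ∫ y, pointGreen α z x y * v y = (∫ y, freeGreen z (x - y) * v y) + _
  have e : ∀ y, pointGreen α z x y * v y = freeGreen z (x - y) * v y +
      freeGreen z x * betaCoeff α z * (conj (freeGreen (conj z) y) * v y) := by
    intro y
    simp only [pointGreen]
    ring
  simp only [e]
  rw [integral_add (integrable_freeGreen_mul hz x (Lp.memLp v))
    ((integrable_conj_mul (memLp_freeGreen (im_conj_ne_zero hz)) v).const_mul _),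
    integral_const_mul, pairingGreen, pairing]
  have : ∫ y, conj (freeGreen (conj z) y) * v y = ∫ y, v y * conj (freeGreen (conj z) y) := by
    refine integral_congr_ae (ae_of_all _ fun y => ?_)
    simp only
    ring
  rw [this]
  ring

theorem ae_ne_zero : ∀ᵐ x : ℝ, x ≠ 0 := compl_mem_ae_iff.2 (measure_singleton (0 : ℝ))

theorem memLp_pointE (v : L2R) (α : ℝ) {z : ℂ} (hz : z.im ≠ 0) (j : Fin 2) :
    MemLp (pointE v α z j) 2 volume := by
  fin_cases j
  · refine (memLp_congr_ae ?_).1 ((memLp_freeGreen hz).const_mul (leftFactor α z))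
    filter_upwards [ae_ne_zero] with x hx
    exact (pointE_zero_apply v α hz hx).symm
  · refine (memLp_congr_ae (ae_of_all _ fun x => ?_)).1 ((memLp_freeE v z hz 1).add
      ((memLp_freeGreen hz).const_mul (betaCoeff α z * pairingGreen v z)))
    exact (pointE_one_apply v α hz x).symm

theorem pairing_pointE_zero_left (v : L2R) (α : ℝ) {z : ℂ} (hz : z.im ≠ 0) :
    pairing (pointE v α z 0) v = leftFactor α z * greenPairing v z := by
  rw [greenPairing, pairing, pairing, ← integral_const_mul]
  refine integral_congr_ae ?_
  filter_upwards [ae_ne_zero] with x hx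
  rw [pointE_zero_apply v α hz hx]
  ring

theorem pairing_pointE_one_left (v : L2R) (α : ℝ) {z : ℂ} (hz : z.im ≠ 0) :
    pairing (pointE v α z 1) v =
      greenForm v z + betaCoeff α z * pairingGreen v z * greenPairing v z := by
  have h : (freeOp z hz v + (betaCoeff α z * pairingGreen v z) • freeGreenL z hz : L2R)
      =ᵐ[volume] pointE v α z 1 := by
    filter_upwards [Lp.coeFn_add (freeOp z hz v)
      ((betaCoeff α z * pairingGreen v z) • freeGreenL z hz),
      Lp.coeFn_smul (betaCoeff α z * pairingGreen v z) (freeGreenL z hz),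
      coeFn_freeOp z hz v, coeFn_freeGreenL z hz] with x h1 h2 h3 h4
    rw [h1, Pi.add_apply, h2, Pi.smul_apply, h3, h4, pointE_one_apply v α hz]
    rfl
  rw [pairing_eq_inner h EventuallyEq.rfl, inner_add_right, inner_smul_right,
    ← greenForm_eq_inner, ← greenPairing_eq_inner]

theorem pointGamma_eq (v : L2R) (α : ℝ) {z : ℂ} (hz : z.im ≠ 0) :
    pointGamma v α z =
      !![-(greenForm v z + betaCoeff α z * pairingGreen v z * greenPairing v z),
        1 + conj (leftFactor α (conj z)) * pairingGreen v z;
        1 + leftFactor α z * greenPairing v z, -(I / 2) * sgnIm z] := by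
  have e : pairing v (pointE v α (conj z) 0) =
      conj (leftFactor α (conj z)) * pairingGreen v z := by
    rw [← conj_pairing, pairing_pointE_zero_left v α (im_conj_ne_zero hz), map_mul,
      conj_greenPairing_conj]
  rw [pointGamma, pairing_pointE_one_left v α hz, pairing_pointE_zero_left v α hz, e]

theorem pointGamma_conj (v : L2R) (α : ℝ) {z : ℂ} (hz : z.im ≠ 0) :
    (pointGamma v α (conj z))ᴴ = pointGamma v α z := by
  rw [pointGamma_eq v α hz, pointGamma_eq v α (im_conj_ne_zero hz)]
  ext i j
  fin_cases i <;> fin_cases j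
  · simp [conj_greenForm_conj v z hz, conj_betaCoeff_conj, conj_pairingGreen_conj,
      conj_greenPairing_conj]
    ring
  · simp [conj_greenPairing_conj]
  · simp [conj_pairingGreen_conj]
  · simp [sgnIm_conj, conj_sgnIm]
    ring

theorem freeGamma_eq (v : L2R) (α : ℝ) (z : ℂ) :
    freeGamma v α z =
      !![greenForm v z - 2 * I * (1 - exp (I * α)) / (1 + exp (I * α)),
        -(2 / (1 + exp (-(I * α)))) - pairingGreen v z;
        -(2 / (1 + exp (I * α))) - greenPairing v z,
        I / (1 + exp (-(I * α))) * (heaviside z.im - exp (-(I * α)) * heaviside (-z.im))] :=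
  rfl

theorem one_add_exp_neg_ne_zero {α : ℝ} (hα : exp (I * α) ≠ -1) : 1 + exp (-(I * α)) ≠ 0 := by
  intro h
  have h1 := exp_neg_mul_exp α
  apply hα
  linear_combination exp (I * α) * h - h1

theorem one_add_exp_ne_zero {α : ℝ} (hα : exp (I * α) ≠ -1) : 1 + exp (I * α) ≠ 0 := fun h =>
  hα (by linear_combination h)

theorem freeGamma_conj (v : L2R) {α : ℝ} (hα : exp (I * α) ≠ -1) {z : ℂ} (hz : z.im ≠ 0) :
    (freeGamma v α (conj z))ᴴ = freeGamma v α z := by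
  have h1 := one_add_exp_neg_ne_zero hα
  have h2 := one_add_exp_ne_zero hα
  have h3 := exp_neg_mul_exp α
  rw [freeGamma_eq, freeGamma_eq]
  ext i j
  fin_cases i <;> fin_cases j
  · simp [conj_greenForm_conj v z hz, conj_exp_I_mul]
    field_simp
    linear_combination 2 * h3
  · simp [conj_greenPairing_conj, conj_exp_I_mul]
  · simp [conj_pairingGreen_conj, conj_exp_neg_I_mul]
  · simp [conj_heaviside, conj_exp_neg_I_mul]
    field_simp
    linear_combination (heaviside (-z.im) + heaviside z.im) * h3

theorem conj_det_of_conjTranspose {A B : Matrix (Fin 2) (Fin 2) ℂ} (h : Aᴴ = B) :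
    conj A.det = B.det := by
  rw [← h, Matrix.det_conjTranspose]
  rfl

/-! ### The resolvent equation -/

/-- The free resolvent of `h - t v` gives `iψ' = h - t v + zψ`, and the nonlocal term `t v` restores
`h`. What remains is consistency of the scalars: `a`, `b` must be the one-sided values, `t` their
weighted mean, and the boundary condition must hold. -/
theorem momentumRel_freeOp_add (v : L2R) (α : ℝ) {z : ℂ} (hz : z.im ≠ 0) (h : L2R) (t c a b : ℂ)
    (ha : a = inner ℂ (freeGreenL (conj z) (im_conj_ne_zero hz)) h - t * pairingGreen v z +
      c * (I * heaviside z.im))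
    (hb : b = inner ℂ (freeGreenL (conj z) (im_conj_ne_zero hz)) h - t * pairingGreen v z +
      c * (-I * heaviside (-z.im)))
    (hs : I * a - I * exp (-(I * α)) * b =
      inner ℂ v (freeOp z hz h) - t * greenForm v z + c * greenPairing v z)
    (ht : t = (a + exp (-(I * α)) * b) / 2) :
    MomentumRel v α (freeOp z hz (h - t • v) + c • freeGreenL z hz)
      (h + z • (freeOp z hz (h - t • v) + c • freeGreenL z hz)) := by
  have hm : inner ℂ (freeGreenL (conj z) (im_conj_ne_zero hz)) (h - t • v) =
      inner ℂ (freeGreenL (conj z) (im_conj_ne_zero hz)) h - t * pairingGreen v z := by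
    rw [inner_sub_right, inner_smul_right, pairingGreen_eq_inner v z hz]
  have hl := hasLeftValue_freeOp_add z hz (h - t • v) c
  have hr := hasRightValue_freeOp_add z hz (h - t • v) c
  rw [hm, ← ha] at hl
  rw [hm, ← hb] at hr
  refine ⟨_, a, b, hasWeakDerivOffZero_freeOp_add z hz (h - t • v) c, hl, hr, ?_, ?_⟩
  · rw [hs, map_sub, map_smul, inner_add_right, inner_sub_right, inner_smul_right,
      inner_smul_right, ← greenForm_eq_inner, ← greenPairing_eq_inner]
  · rw [← ht, smul_smul, mul_neg, I_mul_I, neg_neg, one_smul]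
    module

/-- The linear system that determines the boundary data of the resolvent. -/
theorem boundary_equations (α : ℝ) {z : ℂ} (hz : z.im ≠ 0) {W P M μ ν s t m c : ℂ}
    (hm : m = μ - t * M) (hc : c = betaCoeff α z * m - leftFactor α z * s)
    (h1 : (1 + conj (leftFactor α (conj z)) * M) * t - -(I / 2) * sgnIm z * s =
      conj (leftFactor α (conj z)) * μ)
    (h2 : (1 + leftFactor α z * P) * s - -(W + betaCoeff α z * M * P) * t =
      ν + betaCoeff α z * P * μ) :
    I * (m + c * (I * heaviside z.im)) -
        I * exp (-(I * α)) * (m + c * (-I * heaviside (-z.im))) = ν - t * W + c * P ∧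
      t = (m + c * (I * heaviside z.im) +
        exp (-(I * α)) * (m + c * (-I * heaviside (-z.im)))) / 2 := by
  have he := exp_neg_mul_exp α
  rw [conj_leftFactor_conj] at h1
  rcases lt_or_gt_of_ne hz with h | h
  · simp only [betaCoeff, leftFactor, sgnIm, heaviside_of_neg h, heaviside_of_pos (neg_pos.2 h),
      Real.sign_of_neg h, ofReal_neg, ofReal_one] at *
    subst hc hm
    constructor
    · linear_combination h2 + exp (-(I * α)) * (I * (exp (I * α) - 1) * (μ - t * M) -
        exp (I * α) * s) * I_sq + (s - I * (μ - t * M)) * he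
    · linear_combination h1 + exp (-(I * α)) * (exp (I * α) - 1) * (μ - t * M) / 2 * I_sq -
        (μ - t * M + I * s) / 2 * he
  · simp only [betaCoeff, leftFactor, sgnIm, heaviside_of_pos h,
      heaviside_of_neg (neg_neg_iff_pos.2 h), Real.sign_of_pos h, ofReal_one] at *
    subst hc hm
    constructor
    · linear_combination h2 + (I * (1 - exp (-(I * α))) * (μ - t * M) - s) * I_sq
    · linear_combination h1 - (1 - exp (-(I * α))) * (μ - t * M) / 2 * I_sq

theorem eq_zero_of_momentumRel (v : L2R) (α : ℝ) {z : ℂ} (hz : z.im ≠ 0) {ψ : L2R}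
    (h : MomentumRel v α ψ (z • ψ)) : ψ = 0 := by
  obtain ⟨x, hx, hAx⟩ := (LinearPMap.mem_graph_iff _).1 ((mem_momentumOp_graph v α _ _).2 h)
  simp only at hx hAx
  rw [← hx]
  refine LinearPMap.eq_zero_of_symm (momentumOp_symm v α) hz x ?_
  rw [hAx, hx]

/-- A zero determinant gives a nonzero solution of the homogeneous system, hence a `ψ` with `Aψ =
zψ`. Symmetry forces `ψ = 0`, so its one-sided values and therefore `t` vanish. -/
theorem det_pointGamma_ne_zero (v : L2R) (α : ℝ) {z : ℂ} (hz : z.im ≠ 0) :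
    (pointGamma v α z).det ≠ 0 := by
  intro h0
  rw [pointGamma_eq v α hz, Matrix.det_fin_two_of] at h0
  set W := greenForm v z
  set P := greenPairing v z
  set M := pairingGreen v z
  -- The null vector is `(t, s) = (γ₂₂, γ₁₂)`; its first entry is never zero, whatever `v` and `α`
  -- are.
  set t := -(I / 2) * sgnIm z with ht
  set s := 1 + conj (leftFactor α (conj z)) * M with hs
  have ht0 : t ≠ 0 := by
    rcases lt_or_gt_of_ne hz with h | h
    · simp [ht, sgnIm, Real.sign_of_neg h]
    · simp [ht, sgnIm, Real.sign_of_pos h]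
  obtain ⟨e1, e2⟩ := boundary_equations α hz (W := W) (P := P) (M := M) (μ := 0) (ν := 0)
    (s := s) (t := t) rfl rfl (by rw [← hs, ← ht]; ring) (by linear_combination -h0)
  set c := betaCoeff α z * (0 - t * M) - leftFactor α z * s with hc
  have hrel := momentumRel_freeOp_add v α hz 0 t c
    (0 - t * M + c * (I * heaviside z.im)) (0 - t * M + c * (-I * heaviside (-z.im)))
    (by rw [inner_zero_right]) (by rw [inner_zero_right])
    (by rw [map_zero, inner_zero_right, e1]) e2
  rw [zero_add] at hrel
  have hψ := eq_zero_of_momentumRel v α hz hrel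
  have hl := hasLeftValue_freeOp_add z hz (0 - t • v) c
  have hr := hasRightValue_freeOp_add z hz (0 - t • v) c
  have hmm : inner ℂ (freeGreenL (conj z) (im_conj_ne_zero hz)) (0 - t • v) = 0 - t * M := by
    rw [inner_sub_right, inner_smul_right, ← pairingGreen_eq_inner v z hz, inner_zero_right]
  rw [hψ, hmm] at hl hr
  have ea := hl.eq (tendsto_L2R_zero _)
  have eb := hr.eq (tendsto_L2R_zero _)
  rw [ea, eb] at e2
  exact ht0 (by rw [e2]; simp)

/-! ### Finite-rank perturbations of the free resolvent -/

/-- The bounded operator with kernel `perturbedFreeGreen v z c`. -/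
def perturbedFreeOp (v : L2R) (z : ℂ) (hz : z.im ≠ 0) (c : Matrix (Fin 2) (Fin 2) ℂ) :
    L2R →L[ℂ] L2R :=
  freeOp z hz - ∑ j, ∑ k, c j k •
    (innerSL ℂ (freeEL v (conj z) (im_conj_ne_zero hz) k)).smulRight (freeEL v z hz j)

theorem perturbedFreeOp_apply (v : L2R) (z : ℂ) (hz : z.im ≠ 0) (c : Matrix (Fin 2) (Fin 2) ℂ)
    (h : L2R) :
    perturbedFreeOp v z hz c h = freeOp z hz h - ∑ j,
      (∑ k, c j k * inner ℂ (freeEL v (conj z) (im_conj_ne_zero hz) k) h) • freeEL v z hz j := by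
  simp [perturbedFreeOp, smul_smul, add_smul]

theorem inner_freeEL (v : L2R) (z : ℂ) (hz : z.im ≠ 0) (k : Fin 2) (h : L2R) :
    inner ℂ (freeEL v z hz k) h = ∫ y, conj (freeE v z k y) * h y := by
  rw [inner_L2R_eq]
  refine integral_congr_ae ?_
  filter_upwards [coeFn_freeEL v z hz k] with y hy
  rw [hy, mul_comm]

theorem hasKernel_perturbedFreeOp (v : L2R) (z : ℂ) (hz : z.im ≠ 0)
    (c : Matrix (Fin 2) (Fin 2) ℂ) :
    HasKernel (perturbedFreeOp v z hz c) (perturbedFreeGreen v z c) := by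
  intro h
  have hz' := im_conj_ne_zero hz
  have e : ∀ x y, perturbedFreeGreen v z c x y * h y = freeGreen z (x - y) * h y -
      ∑ j, ∑ k, freeE v z j x * c j k * (conj (freeE v (conj z) k y) * h y) := by
    intro x y
    simp only [perturbedFreeGreen, sub_mul, Finset.sum_mul, mul_assoc]
  have hi1 : ∀ x, Integrable fun y => freeGreen z (x - y) * h y := fun x =>
    integrable_freeGreen_mul hz x (Lp.memLp h)
  have hi2 : ∀ x j k, Integrable fun y =>
      freeE v z j x * c j k * (conj (freeE v (conj z) k y) * h y) := fun x j k =>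
    (integrable_conj_mul (memLp_freeE v (conj z) hz' k) h).const_mul _
  have hi3 : ∀ x j, Integrable fun y =>
      ∑ k, freeE v z j x * c j k * (conj (freeE v (conj z) k y) * h y) := fun x j =>
    integrable_finsetSum _ fun k _ => hi2 x j k
  simp only [e]
  refine ⟨fun x => (hi1 x).sub (integrable_finsetSum _ fun j _ => hi3 x j), ?_⟩
  have hrep : ∀ x, ∫ y, (freeGreen z (x - y) * h y -
      ∑ j, ∑ k, freeE v z j x * c j k * (conj (freeE v (conj z) k y) * h y)) =
      (∫ y, freeGreen z (x - y) * h y) - ∑ j,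
        (∑ k, c j k * inner ℂ (freeEL v (conj z) hz' k) h) * freeE v z j x := by
    intro x
    rw [integral_sub (hi1 x) (integrable_finsetSum _ fun j _ => hi3 x j),
      integral_finsetSum _ fun j _ => hi3 x j]
    congr 1
    refine Finset.sum_congr rfl fun j _ => ?_
    rw [integral_finsetSum _ fun k _ => hi2 x j k, Finset.sum_mul]
    refine Finset.sum_congr rfl fun k _ => ?_
    rw [integral_const_mul, ← inner_freeEL v (conj z) hz']
    ring
  simp only [hrep, perturbedFreeOp_apply, Fin.sum_univ_two (f := fun j : Fin 2 =>
    (∑ k, c j k * inner ℂ (freeEL v (conj z) hz' k) h) • freeEL v z hz j)]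
  set a : Fin 2 → ℂ := fun j => ∑ k, c j k * inner ℂ (freeEL v (conj z) hz' k) h
  filter_upwards [Lp.coeFn_sub (freeOp z hz h)
    (a 0 • freeEL v z hz 0 + a 1 • freeEL v z hz 1),
    Lp.coeFn_add (a 0 • freeEL v z hz 0) (a 1 • freeEL v z hz 1),
    Lp.coeFn_smul (a 0) (freeEL v z hz 0), Lp.coeFn_smul (a 1) (freeEL v z hz 1),
    coeFn_freeEL v z hz 0, coeFn_freeEL v z hz 1, coeFn_freeOp z hz h] with x h1 h2 h3 h4 h5 h6 h7
  rw [h1, Pi.sub_apply, h2, Pi.add_apply, h3, h4, Pi.smul_apply, Pi.smul_apply, h5, h6, h7,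
    Fin.sum_univ_two]
  rfl

/-- The coefficients of the resolvent kernel relative to the free Green function, written with
the entries `A, B, C, D` of `pointGamma`. -/
def coeffOfEntries (v : L2R) (α : ℝ) (z A B C D : ℂ) : Matrix (Fin 2) (Fin 2) ℂ :=
  let κ := leftFactor α z
  let κ' := conj (leftFactor α (conj z))
  let β := betaCoeff α z
  let P := greenPairing v z
  let M := pairingGreen v z
  !![-(β + ((κ * A + β * M * C) * κ' + (κ * B + β * M * D) * (β * P)) / (A * D - B * C)),
    -(κ * B + β * M * D) / (A * D - B * C);
    -(C * κ' + D * (β * P)) / (A * D - B * C), -D / (A * D - B * C)]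

/-- The coefficients of the resolvent kernel relative to the free Green function. -/
def resolventCoeff (v : L2R) (α : ℝ) (z : ℂ) : Matrix (Fin 2) (Fin 2) ℂ :=
  coeffOfEntries v α z (pointGamma v α z 0 0) (pointGamma v α z 0 1) (pointGamma v α z 1 0)
    (pointGamma v α z 1 1)

/-- The system `B t - D s = r₁`, `C s - A t = r₂` has matrix rows `(B, -D)` and `(-A, C)`. Its
inverse is built from `A, B, C, D` themselves up to sign, which is why the kernel contains the
entries of `pointGamma` and not those of its inverse. -/
theorem cramer_fst {A B C D r₁ r₂ : ℂ} (h : A * D - B * C ≠ 0) :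
    B * (-(C * r₁ + D * r₂) / (A * D - B * C)) - D * (-(B * r₂ + A * r₁) / (A * D - B * C)) =
      r₁ := by
  have e : B * (-(C * r₁ + D * r₂)) - D * (-(B * r₂ + A * r₁)) = r₁ * (A * D - B * C) := by ring
  rw [← mul_div_assoc, ← mul_div_assoc, ← sub_div, e, mul_div_cancel_right₀ _ h]

theorem cramer_snd {A B C D r₁ r₂ : ℂ} (h : A * D - B * C ≠ 0) :
    C * (-(B * r₂ + A * r₁) / (A * D - B * C)) - A * (-(C * r₁ + D * r₂) / (A * D - B * C)) =
      r₂ := by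
  have e : C * (-(B * r₂ + A * r₁)) - A * (-(C * r₁ + D * r₂)) = r₂ * (A * D - B * C) := by ring
  rw [← mul_div_assoc, ← mul_div_assoc, ← sub_div, e, mul_div_cancel_right₀ _ h]

theorem nonlocalGreen_eq (v : L2R) (α : ℝ) {z : ℂ} (hz : z.im ≠ 0) {x y : ℝ} (hx : x ≠ 0)
    (hy : y ≠ 0) :
    nonlocalGreen v α z x y = perturbedFreeGreen v z (resolventCoeff v α z) x y := by
  have hf0 : freeE v z 0 x = freeGreen z x := rfl
  have hf0' : freeE v (conj z) 0 y = freeGreen (conj z) y := rfl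
  simp only [resolventCoeff, coeffOfEntries, nonlocalGreen, perturbedFreeGreen, pointGreen, Fin.sum_univ_two,
    pointE_zero_apply v α hz hx, pointE_one_apply v α hz,
    pointE_zero_apply v α (im_conj_ne_zero hz) hy, pointE_one_apply v α (im_conj_ne_zero hz),
    map_add, map_mul, conj_betaCoeff_conj, conj_pairingGreen_conj, Matrix.det_fin_two, hf0, hf0']
  simp
  ring

theorem memLp_nonlocalGreen (v : L2R) (α : ℝ) {z : ℂ} (hz : z.im ≠ 0) (x : ℝ) :
    MemLp (nonlocalGreen v α z x) 2 volume := by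
  have hz' := im_conj_ne_zero hz
  have h1 : MemLp (fun y => conj (freeGreen (conj z) y)) 2 volume := (memLp_freeGreen hz').star
  have h2 : ∀ k, MemLp (fun y => conj (pointE v α (conj z) k y)) 2 volume := fun k =>
    (memLp_pointE v α hz' k).star
  have h3 : MemLp (fun y => pointGreen α z x y) 2 volume :=
    (memLp_freeGreen_sub hz x).add (h1.const_mul (freeGreen z x * betaCoeff α z))
  have h4 : ∀ j k, MemLp (fun y => pointE v α z j x * pointGamma v α z j k *
      conj (pointE v α (conj z) k y)) 2 volume := fun j k => (h2 k).const_mul _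
  have h5 : MemLp (fun y => ∑ j, ∑ k, pointE v α z j x * pointGamma v α z j k *
      conj (pointE v α (conj z) k y)) 2 volume :=
    memLp_finsetSum _ fun j _ => memLp_finsetSum _ fun k _ => h4 j k
  exact h3.add (h5.const_mul (1 / (pointGamma v α z).det))

/-- The kernels agree only off the axes, which is enough almost everywhere; `HasKernel` also asks
for integrability at every `x`, including zero, hence the separate `MemLp` hypothesis. -/
theorem hasKernel_congr {R : L2R →L[ℂ] L2R} {K K' : ℝ → ℝ → ℂ} (h : HasKernel R K)
    (hK' : ∀ x, MemLp (K' x) 2 volume) (hKK' : ∀ x y : ℝ, x ≠ 0 → y ≠ 0 → K' x y = K x y) :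
    HasKernel R K' := by
  intro f
  refine ⟨fun x => MemLp.integrable_mul (p := 2) (q := 2) (hK' x) (Lp.memLp f), ?_⟩
  filter_upwards [(h f).2, ae_ne_zero] with x hx hx0
  rw [hx]
  refine integral_congr_ae ?_
  filter_upwards [ae_ne_zero] with y hy0
  rw [hKK' x y hx0 hy0]

theorem momentumRel_perturbedFreeOp (v : L2R) (α : ℝ) {z : ℂ} (hz : z.im ≠ 0) (h : L2R) :
    MomentumRel v α (perturbedFreeOp v z hz (resolventCoeff v α z) h)
      (h + z • perturbedFreeOp v z hz (resolventCoeff v α z) h) := by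
  have hdet := det_pointGamma_ne_zero v α hz
  have hΓ := pointGamma_eq v α hz
  have hcoeff : resolventCoeff v α z = coeffOfEntries v α z _ _ _ _ := rfl
  rw [hΓ] at hcoeff
  simp only [coeffOfEntries, Matrix.of_apply, Matrix.cons_val_zero, Matrix.cons_val_one,
    Matrix.cons_val', Matrix.cons_val_fin_one] at hcoeff
  rw [hΓ, Matrix.det_fin_two_of] at hdet
  set W := greenForm v z
  set P := greenPairing v z
  set M := pairingGreen v z
  set β := betaCoeff α z
  set κ := leftFactor α z
  set κ' := conj (leftFactor α (conj z))
  set A := -(W + β * M * P) with hA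
  set B := 1 + κ' * M with hB
  set C := 1 + κ * P with hC
  set D := -(I / 2) * sgnIm z with hD
  set μ := inner ℂ (freeGreenL (conj z) (im_conj_ne_zero hz)) h with hμ
  set ν := inner ℂ v (freeOp z hz h) with hν
  set t := -(C * (κ' * μ) + D * (ν + β * P * μ)) / (A * D - B * C) with ht
  set s := -(B * (ν + β * P * μ) + A * (κ' * μ)) / (A * D - B * C) with hs
  set c := β * (μ - t * M) - κ * s with hc
  obtain ⟨e1, e2⟩ := boundary_equations α hz (W := W) (P := P) (M := M) (μ := μ) (ν := ν)
    (s := s) (t := t) rfl hc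
    (cramer_fst hdet) (cramer_snd hdet)
  -- The coefficients are read off from this ansatz: the row of `g_z` carries `-c` and the row of
  -- `e₂` carries `t`, each linear in `μ` and `ν`.
  have hR : perturbedFreeOp v z hz (resolventCoeff v α z) h =
      freeOp z hz (h - t • v) + c • freeGreenL z hz := by
    have i0 : inner ℂ (freeEL v (conj z) (im_conj_ne_zero hz) 0) h = μ := rfl
    have i1 : inner ℂ (freeEL v (conj z) (im_conj_ne_zero hz) 1) h = ν := by
      rw [hν, ← conj_inner_L2R (freeOp z hz h), inner_freeOp_left, conj_inner_L2R]
      rfl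
    have ec : -(-(β + ((κ * A + β * M * C) * κ' + (κ * B + β * M * D) * (β * P)) /
        (A * D - B * C)) * μ + -(κ * B + β * M * D) / (A * D - B * C) * ν) = c := by
      rw [hc, ht, hs]
      ring
    have et : -(C * κ' + D * (β * P)) / (A * D - B * C) * μ + -D / (A * D - B * C) * ν = t := by
      rw [ht]
      ring
    rw [perturbedFreeOp_apply, hcoeff]
    simp only [Fin.sum_univ_two, i0, i1]
    simp only [Matrix.of_apply, Matrix.cons_val_zero, Matrix.cons_val_one, Matrix.cons_val',
      Matrix.cons_val_fin_one]
    rw [et, ← ec]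
    simp only [freeEL, Matrix.cons_val_zero, Matrix.cons_val_one, map_sub, map_smul]
    module
  rw [hR]
  exact momentumRel_freeOp_add v α hz h t c _ _ rfl rfl e1 e2

/-- The solved boundary problem gives a right inverse; it is also a left inverse because a symmetric
operator has no nonreal eigenvalue. -/
theorem isResolvent_perturbedFreeOp (v : L2R) (α : ℝ) {z : ℂ} (hz : z.im ≠ 0) :
    IsResolvent (momentumOp v α) z (perturbedFreeOp v z hz (resolventCoeff v α z)) := by
  have key : ∀ h : L2R, ∃ hd : perturbedFreeOp v z hz (resolventCoeff v α z) h ∈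
      (momentumOp v α).domain, momentumOp v α ⟨_, hd⟩ -
        z • perturbedFreeOp v z hz (resolventCoeff v α z) h = h := by
    intro h
    obtain ⟨x, hx, hAx⟩ := (LinearPMap.mem_graph_iff _).1
      ((mem_momentumOp_graph v α _ _).2 (momentumRel_perturbedFreeOp v α hz h))
    simp only at hx hAx
    refine ⟨hx ▸ x.2, ?_⟩
    have : (⟨_, hx ▸ x.2⟩ : (momentumOp v α).domain) = x := Subtype.ext hx.symm
    rw [this, hAx, add_sub_cancel_right]
  refine ⟨key, fun ψ => ?_⟩
  obtain ⟨hd, hR⟩ := key (momentumOp v α ψ - z • (ψ : L2R))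
  rw [sub_eq_sub_iff_add_eq_add] at hR
  have h0 := LinearPMap.eq_zero_of_symm (momentumOp_symm v α) hz (⟨_, hd⟩ - ψ) (by
    rw [LinearPMap.map_sub, AddSubgroupClass.coe_sub, smul_sub]
    rw [sub_eq_sub_iff_add_eq_add, hR, add_comm])
  exact sub_eq_zero.1 h0

/-! ### The coefficients in terms of `freeGamma` -/

/-- With the scalar factor removed, the entries are polynomial in `q = e^{-iα}` and match the
numerators of `resolventCoeff`; in the lower half-plane the same happens with `q = e^{iα}`. -/
theorem freeGamma_of_im_pos (v : L2R) {α : ℝ} (hα : exp (I * α) ≠ -1) {z : ℂ} (hz : 0 < z.im) :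
    freeGamma v α z = (2 / (1 + exp (-(I * α)))) •
      !![(1 + exp (-(I * α))) / 2 * greenForm v z + I * (1 - exp (-(I * α))),
        -1 - (1 + exp (-(I * α))) / 2 * pairingGreen v z;
        -exp (-(I * α)) - (1 + exp (-(I * α))) / 2 * greenPairing v z, I / 2] := by
  have h1 := one_add_exp_neg_ne_zero hα
  have h2 := one_add_exp_ne_zero hα
  have h3 := exp_neg_mul_exp α
  rw [freeGamma_eq, heaviside_of_pos hz, heaviside_of_neg (neg_neg_iff_pos.2 hz)]
  ext i j
  fin_cases i <;> fin_cases j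
  · simp
    field_simp
    linear_combination 4 * I * h3
  · simp
    field_simp
  · simp
    field_simp
    linear_combination 2 * h3
  · simp

theorem freeGamma_of_im_neg (v : L2R) {α : ℝ} (hα : exp (I * α) ≠ -1) {z : ℂ} (hz : z.im < 0) :
    freeGamma v α z = (2 / (1 + exp (I * α))) •
      !![(1 + exp (I * α)) / 2 * greenForm v z - I * (1 - exp (I * α)),
        -exp (I * α) - (1 + exp (I * α)) / 2 * pairingGreen v z;
        -1 - (1 + exp (I * α)) / 2 * greenPairing v z, -(I / 2)] := by
  have h1 := one_add_exp_neg_ne_zero hα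
  have h2 := one_add_exp_ne_zero hα
  have h3 := exp_neg_mul_exp α
  rw [freeGamma_eq, heaviside_of_neg hz, heaviside_of_pos (neg_pos.2 hz)]
  ext i j
  fin_cases i <;> fin_cases j
  · simp
    field_simp
  · simp
    field_simp
    linear_combination 2 * h3
  · simp
    field_simp
  · simp
    field_simp
    linear_combination h3

/-- If `G = l N` and `l det N = δ`, then `det G = l² det N = l δ`, so `G / det G = N / δ`: the
scalar cancels. In the application `δ` is the determinant of `pointGamma`, so its nonvanishing
carries over to `freeGamma`. -/
theorem smul_inv_det_eq {G : Matrix (Fin 2) (Fin 2) ℂ} {l n₁ n₂ n₃ n₄ β X m₂ m₃ m₄ δ : ℂ}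
    (hG : G = l • !![n₁, n₂; n₃, n₄]) (hl : l ≠ 0) (hδ : δ ≠ 0)
    (hdet : l * (n₁ * n₄ - n₂ * n₃) = δ) (h₁ : n₁ = -(β * δ + X)) (h₂ : n₂ = m₂) (h₃ : n₃ = m₃)
    (h₄ : n₄ = m₄) :
    G.det ≠ 0 ∧ (1 / G.det) • G = !![-(β + X / δ), m₂ / δ; m₃ / δ, m₄ / δ] := by
  have hd : G.det = l * δ := by
    rw [hG, Matrix.det_smul, Matrix.det_fin_two_of, Fintype.card_fin, ← hdet]
    ring
  have e₁ : -(β + X / δ) = n₁ / δ := by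
    rw [h₁]
    field_simp
  refine ⟨hd ▸ mul_ne_zero hl hδ, ?_⟩
  have : 1 / (l * δ) * l = δ⁻¹ := by field_simp
  rw [hd, e₁, hG, smul_smul, this, h₂, h₃, h₄]
  ext i j
  fin_cases i <;> fin_cases j <;> simp [div_eq_inv_mul]

theorem freeGamma_eq_resolventCoeff (v : L2R) {α : ℝ} (hα : exp (I * α) ≠ -1) {z : ℂ}
    (hz : z.im ≠ 0) :
    (freeGamma v α z).det ≠ 0 ∧
      (1 / (freeGamma v α z).det) • freeGamma v α z = resolventCoeff v α z := by
  have h1 := one_add_exp_neg_ne_zero hα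
  have h2 := one_add_exp_ne_zero hα
  have hdet := det_pointGamma_ne_zero v α hz
  have hΓ := pointGamma_eq v α hz
  have hcoeff : resolventCoeff v α z = coeffOfEntries v α z _ _ _ _ := rfl
  rw [hΓ] at hcoeff
  simp only [coeffOfEntries, Matrix.of_apply, Matrix.cons_val_zero, Matrix.cons_val_one,
    Matrix.cons_val', Matrix.cons_val_fin_one] at hcoeff
  rw [hΓ, Matrix.det_fin_two_of] at hdet
  rw [hcoeff]
  clear hcoeff hΓ
  rw [conj_leftFactor_conj] at *
  set W := greenForm v z
  set P := greenPairing v z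
  set M := pairingGreen v z
  rcases lt_or_gt_of_ne hz with h | h
  · have hG := freeGamma_of_im_neg v hα h
    simp only [betaCoeff, leftFactor, sgnIm, heaviside_of_neg h, heaviside_of_pos (neg_pos.2 h),
      Real.sign_of_neg h, ofReal_neg, ofReal_one] at *
    set q := exp (I * α)
    refine smul_inv_det_eq hG (div_ne_zero two_ne_zero h2) hdet ?_ ?_ ?_ ?_ ?_
    · rw [div_mul_eq_mul_div, div_eq_iff h2]
      linear_combination (-(q - 1) + (q - 1) * (1 + q) / 2 * M * P) * I_sq
    · linear_combination -(q - 1) * W / 2 * I_sq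
    · linear_combination (q - 1) * M / 2 * I_sq
    · linear_combination (q - 1) * P / 2 * I_sq
    · ring
  · have hG := freeGamma_of_im_pos v hα h
    simp only [betaCoeff, leftFactor, sgnIm, heaviside_of_pos h,
      heaviside_of_neg (neg_neg_iff_pos.2 h), Real.sign_of_pos h, ofReal_one] at *
    set q := exp (-(I * α))
    refine smul_inv_det_eq hG (div_ne_zero two_ne_zero h1) hdet ?_ ?_ ?_ ?_ ?_
    · rw [div_mul_eq_mul_div, div_eq_iff h1]
      linear_combination ((1 - q) - (1 - q) * (1 + q) / 2 * M * P) * I_sq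
    · linear_combination (1 - q) * W / 2 * I_sq
    · linear_combination -(1 - q) * M / 2 * I_sq
    · linear_combination -(1 - q) * P / 2 * I_sq
    · ring

theorem momentumOp_sub_smul_surjective (v : L2R) (α : ℝ) {z : ℂ} (hz : z.im ≠ 0) (h : L2R) :
    ∃ x : (momentumOp v α).domain, momentumOp v α x - z • (x : L2R) = h := by
  obtain ⟨hd, hR⟩ := (isResolvent_perturbedFreeOp v α hz).1 h
  exact ⟨⟨_, hd⟩, hR⟩

end

theorem theorem2p4 (v : L2R) (α : ℝ) :
    Dense ((momentumOp v α).domain : Set L2R) ∧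
    IsSelfAdjoint (momentumOp v α) ∧
    ∀ z : ℂ, z.im ≠ 0 →
      (∀ j, MemLp (pointE v α z j) 2 volume) ∧
      (∀ j, MemLp (freeE v z j) 2 volume) ∧
      (pointGamma v α (conj z))ᴴ = pointGamma v α z ∧
      conj (pointGamma v α (conj z)).det = (pointGamma v α z).det ∧
      (pointGamma v α z).det ≠ 0 ∧
      ∃ R : L2R →L[ℂ] L2R,
        IsResolvent (momentumOp v α) z R ∧
        HasKernel R (nonlocalGreen v α z) ∧
        (∃ c : Matrix (Fin 2) (Fin 2) ℂ,
          HasKernel R (perturbedFreeGreen v z c) ∧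
          ∀ x y : ℝ, x ≠ 0 → y ≠ 0 →
            nonlocalGreen v α z x y = perturbedFreeGreen v z c x y) ∧
        (exp (I * α) ≠ -1 →
          (freeGamma v α (conj z))ᴴ = freeGamma v α z ∧
          conj (freeGamma v α (conj z)).det = (freeGamma v α z).det ∧
          (freeGamma v α z).det ≠ 0 ∧
          HasKernel R (perturbedFreeGreen v z ((1 / (freeGamma v α z).det) • freeGamma v α z)) ∧
          ∀ x y : ℝ, x ≠ 0 → y ≠ 0 →
            nonlocalGreen v α z x y =
              perturbedFreeGreen v z ((1 / (freeGamma v α z).det) • freeGamma v α z) x y) := by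
  have hI : I.im ≠ 0 := by simp
  have h₁ := momentumOp_sub_smul_surjective v α hI
  have h₂ := momentumOp_sub_smul_surjective v α (im_conj_ne_zero hI)
  refine ⟨LinearPMap.dense_domain_of_symm_of_surjective (momentumOp_symm v α) h₁ h₂,
    LinearPMap.isSelfAdjoint_of_symm_of_surjective (momentumOp_symm v α) h₁ h₂, fun z hz => ?_⟩
  have hΓ := pointGamma_conj v α hz
  have hker := hasKernel_perturbedFreeOp v z hz (resolventCoeff v α z)
  have heq : ∀ x y : ℝ, x ≠ 0 → y ≠ 0 →
      nonlocalGreen v α z x y = perturbedFreeGreen v z (resolventCoeff v α z) x y :=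
    fun x y hx hy => nonlocalGreen_eq v α hz hx hy
  -- A single operator, defined by the free form of the kernel, serves all the kernel claims; the
  -- other forms follow from equality off the axes or equality of the coefficient matrices.
  refine ⟨memLp_pointE v α hz, memLp_freeE v z hz, hΓ, conj_det_of_conjTranspose hΓ,
    det_pointGamma_ne_zero v α hz, perturbedFreeOp v z hz (resolventCoeff v α z),
    isResolvent_perturbedFreeOp v α hz, hasKernel_congr hker (memLp_nonlocalGreen v α hz) heq,
    ⟨_, hker, heq⟩, fun hα => ?_⟩
  have hΓ' := freeGamma_conj v hα hz
  obtain ⟨hdet, hcoeff⟩ := freeGamma_eq_resolventCoeff v hα hz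
  rw [hcoeff]
  exact ⟨hΓ', conj_det_of_conjTranspose hΓ', hdet, hker, heq⟩
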